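/- Let $M\ge 0$, let $k_1\le\dots\le k_M\le L$ be non-negative integers, put $k_{M+1}=L$, and let $I^{(1)}\subset I^{(2)}\subset\dots\subset I^{(M)}\subset I^{(M+1)}=\{1,\dots,L\}$ with $I^{(p)}=\{I^{(p)}_1<\dots<I^{(p)}_{k_p}\}$. Let $\widetilde I^{(p)}_a\in\{1,\dots,k_{p+1}\}$ be the position of $I^{(p)}_a$ in the ordered set $I^{(p+1)}$; thus $\widetilde I^{(M)}=I^{(M)}$. Let $u^{(p)}=(u^{(p)}_1,\dots,u^{(p)}_{k_p})$, $1\le p\le M$, $u^{(M+1)}=m=(m_1,\dots,m_L)$, $\gamma$ and $\hbar$ be complex parameters, and write $u^{(p)}_{a,b}=u^{(p)}_a-u^{(p)}_b$. $\operatorname{Sym}$ denotes the sum over all permutations of the variables within each of $u^{(1)},\dots,u^{(M)}$. *Orbifold defect.* The total equivariant character of the $A_M$ quiver with gauge nodes $U(k_1),\dots,U(k_M)$ and with flavours $U(L)$ at the last node only is $$\chi(u,m,\gamma,\hbar)=\frac1{1-e^{\hbar}}\sum_{p=1}^M\Big(-\sum_{a\ne b}e^{u^{(p)}_{a,b}}+\sum_{a,b}e^{u^{(p)}_{a,b}+\gamma+\hbar}+\sum_{a=1}^{k_p}\sum_{b=1}^{k_{p+1}}\big(e^{u^{(p)}_a-u^{(p+1)}_b-\gamma/2}+e^{-u^{(p)}_a+u^{(p+1)}_b-\gamma/2}\big)\Big).$$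 Substitute $u^{(p)}_a\to u^{(p)}_a+(I^{(p)}_a-1)\hbar/L$, $m_i\to m_i+(i-1)\hbar/L$, $\hbar\to\hbar/L$, and take the $\mathbb Z_L$-invariant part, i.e. the average over $\hbar\to\hbar+2\pi i n$, $n=0,\dots,L-1$. A *defect character* is a finite formal sum $c=\sum_I e^{w_I}-\sum_J e^{v_J}$ of exponentials of linear forms in $(u,m,\gamma,\hbar)$ by which this invariant part exceeds $\chi$, for all values of the parameters with $e^{\hbar}\ne1$. The defect is $\psi=\operatorname{Sym}\big(\prod_Jv_J/\prod_Iw_I\big)$, and the normalized defect is $$\widehat\psi=\prod_{p=1}^M\Big((-1)^{k_pk_{p+1}+\sum_a\widetilde I^{(p)}_a}\prod_{a<b}\big(\gamma^2-(u^{(p)}_{a,b})^2\big)\Big)\,\psi .$$ *Blocks.* For $I=\{I_1<\dots<I_n\}\subset\{1,\dots,N\}$ let $$\omega^{(N)}_I(u;v)=\prod_{a=1}^n\Big(\prod_{i<I_a}\big(u_a-v_i-\tfrac\gamma2\big)\prod_{i>I_a}\big(u_a-v_i+\tfrac\gamma2\big)\Big)\prod_{a<b}\frac{u_a-u_b-\gamma}{u_a-u_b},$$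 $$\Omega=\operatorname{Sym}\Big(\prod_{p=1}^{M-1}\omega^{(k_{p+1})}_{\widetilde I^{(p)}}\big(u^{(p)};u^{(p+1)}\big)\cdot\omega^{(L)}_{I^{(M)}}\big(u^{(M)};m\big)\Big).$$ *Nested coordinate Bethe wavefunction* of the inhomogeneous $\mathfrak{su}(M+1)$ XXX chain with fundamental spins, with free (off-shell) rapidities: it is defined recursively by $\Psi_0=1$ and, for $q=1,\dots,M$ and inhomogeneities $v=(v_1,\dots,v_{k_{q+1}})$, $$\Psi_q(v)=\sum_{\sigma\in\mathfrak S_{k_q}}\ \prod_{a<b}\frac{x_a-x_b-\gamma}{x_a-x_b}\ \prod_{a=1}^{k_q}\Big(\frac1{x_a-v_{s_a}+\frac\gamma2}\prod_{i<s_a}\frac{x_a-v_i-\frac\gamma2}{x_a-v_i+\frac\gamma2}\Big)\ \Psi_{q-1}(x),$$ where $x_a=u^{(q)}_{\sigma(a)}$ and $s_a=\widetilde I^{(q)}_a$; the wavefunction is $\Psi=\Psi_M(m)$. *Vertex model.* For each $p=1,\dots,M$ take a rectangular block with $k_p$ horizontal lines, numbered from top to bottom, carrying $x^{(p)}_1,\dots,x^{(p)}_{k_p}$,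 and $k_{p+1}$ vertical lines, numbered from left to right, carrying $x^{(p+1)}_1,\dots,x^{(p+1)}_{k_{p+1}}$ (for $p=M$: $y_1,\dots,y_L$). For $p<M$ the top bond of the $b$-th vertical line of block $p$ is joined to the left bond of the $b$-th horizontal line of block $p+1$. Bonds carry colours in $\{1,\dots,M+1\}$. The left bonds of block $1$ have colour $1$, the right and lower boundary bonds of block $p$ have colour $p+1$, and the $\ell$-th top bond of block $M$ has colour $1$ if $\ell\in I^{(1)}$, $p$ if $\ell\in I^{(p)}\setminus I^{(p-1)}$ ($2\le p\le M$), and $M+1$ if $\ell\notin I^{(M)}$. A vertex where a horizontal line with variable $x$ crosses a vertical line with variable $y$ has weight $x-y+1$ if its four bonds have the same colour; $x-y$ if left $=$ right, bottom $=$ top, and these two colours differ; $1$ if left $=$ top, bottom $=$ right, and these two colours differ; and $0$ otherwise. The partition function $Z(x;y)$ is the sum over all colourings of the bonds with these boundary conditions of the product of the vertex weights. **Claim.** 1. There is exactly one defect character. If $u^{(p)}_a\ne u^{(p)}_b$ and $u^{(p)}_{a,b}+\gamma\neq0$ for all $p$ and $a\ne b$, then $\widehat\psi=\Omega$. 2.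 $\widehat\psi$ is, up to a normalization that does not depend on the index sets, the nested coordinate Bethe wavefunction: if $u^{(p)}_a\ne u^{(p)}_b$ for all $p$ and $a\neq b$, and $u^{(p)}_a-u^{(p+1)}_b+\frac\gamma2\ne0$ for all $p,a,b$, then $$\Omega=\prod_{p=1}^M\prod_{a=1}^{k_p}\prod_{b=1}^{k_{p+1}}\Big(u^{(p)}_a-u^{(p+1)}_b+\frac\gamma2\Big)\cdot\Psi .$$ 3. $\widehat\psi$ is the partition function of the vertex model: for $\gamma=1$, if $u^{(p)}_a\ne u^{(p)}_b$ for all $p$ and $a\ne b$, then $\Omega=Z(x;y)$ with $x^{(p)}_a=u^{(p)}_a-\frac{M-p+1}2$ and $y_i=m_i$. -/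

import Mathlib

noncomputable section

namespace AMQuiver

/-! Levels are numbered `0, …, M`. Levels `p.castSucc`, for `p : Fin M`, are the `M` gauge nodes
`U(k₁), …, U(k_M)` of the simple `A_M` quiver, and the level `Fin.last M` is the flavour node
`U(L)`, so that `k (Fin.last M)` is `L`. Gauge node `p` is linked to the level `p.succ`. All
positions `1, 2, …` are shifted by one: the set `{1, …, n}` is `Fin n`. -/

/-- Nested index sets `I⁽¹⁾ ⊆ I⁽²⁾ ⊆ ⋯ ⊆ I⁽ᴹ⁾ ⊆ {1, …, L}` with `|I⁽ᵖ⁾| = k_p`. The set at the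
flavour level has `L` elements, hence it is all of `{1, …, L}`. -/
structure NestedSets {M : ℕ} (k : Fin (M + 1) → ℕ) where
  set : Fin (M + 1) → Finset (Fin (k (Fin.last M)))
  card_eq : ∀ p, (set p).card = k p
  subset_succ : ∀ p : Fin M, set p.castSucc ⊆ set p.succ

variable {M : ℕ} {k : Fin (M + 1) → ℕ}

/-- `I⁽ᵖ⁾_a`, the `a`-th element of `I⁽ᵖ⁾` in increasing order. -/
def NestedSets.pos (I : NestedSets k) (p : Fin (M + 1)) (a : Fin (k p)) : Fin (k (Fin.last M)) :=
  (I.set p).orderEmbOfFin (I.card_eq p) a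

/-- `Ĩ⁽ᵖ⁾_a`, the image of `I⁽ᵖ⁾_a` under the bijection `I⁽ᵖ⁺¹⁾_b ↦ b`. For the last gauge node
this is `I⁽ᴹ⁾_a` itself. -/
def NestedSets.tilde (I : NestedSets k) (p : Fin M) (a : Fin (k p.castSucc)) : Fin (k p.succ) :=
  ((I.set p.succ).orderIsoOfFin (I.card_eq p.succ)).symm
    ⟨I.pos p.castSucc a,
      I.subset_succ p ((I.set p.castSucc).orderEmbOfFin_mem (I.card_eq p.castSucc) a)⟩

/-- The colours of the positions: colour `1` on `I⁽¹⁾`, colour `p` on `I⁽ᵖ⁾ \ I⁽ᵖ⁻¹⁾`, and colour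
`M + 1` outside `I⁽ᴹ⁾` (the colours `1, …, M + 1` are `Fin (M + 1)`). -/
def NestedSets.colour (I : NestedSets k) (l : Fin (k (Fin.last M))) : Fin (M + 1) :=
  ⟨(Finset.univ.filter fun p : Fin M => l ∉ I.set p.castSucc).card,
    Nat.lt_succ_of_le ((Finset.card_le_univ _).trans_eq (Fintype.card_fin M))⟩

/-- The gauge variables `u` together with the masses `m` at the flavour level. -/
def levels (u : ∀ p : Fin M, Fin (k p.castSucc) → ℂ) (m : Fin (k (Fin.last M)) → ℂ) :
    ∀ p : Fin (M + 1), Fin (k p) → ℂ :=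
  Fin.lastCases (motive := fun p => Fin (k p) → ℂ) m u

/-- `Sym` over `u⁽¹⁾, …, u⁽ᴹ⁾`: the sum over all permutations of the variables at each node. -/
def sym (f : (∀ p : Fin M, Fin (k p.castSucc) → ℂ) → ℂ)
    (u : ∀ p : Fin M, Fin (k p.castSucc) → ℂ) : ℂ :=
  ∑ σ : ∀ p : Fin M, Equiv.Perm (Fin (k p.castSucc)), f fun p a => u p (σ p a)

/-! ### Equivariant characters and the orbifold -/

/-- The parameters `((u⁽¹⁾, …, u⁽ᴹ⁾, m), γ, ħ)`. -/
abbrev Params {M : ℕ} (k : Fin (M + 1) → ℕ) : Type :=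
  (∀ p : Fin (M + 1), Fin (k p) → ℂ) × ℂ × ℂ

/-- The character of the vector multiplet `V⁽ᵖ⁾`. -/
def charV (p : Fin M) (z : Params k) : ℂ :=
  -∑ a : Fin (k p.castSucc), ∑ b : Fin (k p.castSucc),
    if a = b then 0
    else Complex.exp (z.1 p.castSucc a - z.1 p.castSucc b) / (1 - Complex.exp z.2.2)

/-- The character of the adjoint multiplet `Φ⁽ᵖ⁾`. -/
def charPhi (p : Fin M) (z : Params k) : ℂ :=
  ∑ a : Fin (k p.castSucc), ∑ b : Fin (k p.castSucc),
    Complex.exp (z.1 p.castSucc a - z.1 p.castSucc b + z.2.1 + z.2.2) / (1 - Complex.exp z.2.2)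

/-- The character of the bifundamental `A⁽ᵖ⁾`; at the last gauge node, the sum over `i` of the
characters of the fundamentals `X_i`. -/
def charA (p : Fin M) (z : Params k) : ℂ :=
  ∑ a : Fin (k p.castSucc), ∑ b : Fin (k p.succ),
    Complex.exp (z.1 p.castSucc a - z.1 p.succ b - z.2.1 / 2) / (1 - Complex.exp z.2.2)

/-- The character of the anti-bifundamental `B⁽ᵖ⁾`; at the last gauge node, the sum over `i` of the
characters of the anti-fundamentals `Y_i`. -/
def charB (p : Fin M) (z : Params k) : ℂ :=
  ∑ a : Fin (k p.castSucc), ∑ b : Fin (k p.succ),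
    Complex.exp (-z.1 p.castSucc a + z.1 p.succ b - z.2.1 / 2) / (1 - Complex.exp z.2.2)

/-- The total equivariant character of the simple `A_M` quiver. -/
def totalChar (z : Params k) : ℂ :=
  ∑ p : Fin M, (charV p z + charPhi p z + charA p z + charB p z)

/-- The orbifold change of parameters `u⁽ᵖ⁾_a → u⁽ᵖ⁾_a + (I⁽ᵖ⁾_a - 1) ħ / L`,
`m_i → m_i + (i - 1) ħ / L`, `ħ → ħ / L`. At the flavour level `I_i = i`. -/
def NestedSets.orbifoldShift (I : NestedSets k) (z : Params k) : Params k :=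
  (fun p a => z.1 p a + ((I.pos p a : ℕ) : ℂ) * (z.2.2 / (k (Fin.last M) : ℂ)),
    z.2.1, z.2.2 / (k (Fin.last M) : ℂ))

/-- The part of the orbifolded total character that is invariant under `ħ → ħ + 2πi n`,
`n = 0, …, L - 1`: the average over this action of `ℤ_L`. -/
def NestedSets.invariantChar (I : NestedSets k) (z : Params k) : ℂ :=
  (1 / (k (Fin.last M) : ℂ)) * ∑ n : Fin (k (Fin.last M)),
    totalChar (I.orbifoldShift (z.1, z.2.1, z.2.2 + 2 * Real.pi * Complex.I * ((n : ℕ) : ℂ)))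

/-- Finite formal sums `∑ e^{w_I} - ∑ e^{v_J}` of exponentials of linear forms in the parameters;
the coefficient of `w` is its multiplicity counted with sign. -/
abbrev ExpSum {M : ℕ} (k : Fin (M + 1) → ℕ) : Type :=
  Module.Dual ℂ (Params k) →₀ ℤ

/-- `c` is the contribution of the defect to the character: what the `ℤ_L`-invariant part of the
orbifolded total character has in addition to the total character. -/
def NestedSets.IsDefectChar (I : NestedSets k) (c : ExpSum k) : Prop :=
  ∀ z : Params k, Complex.exp z.2.2 ≠ 1 →
    I.invariantChar z = totalChar z + c.sum fun w n => (n : ℂ) * Complex.exp (w z)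

/-- The rational partition function `∏ v_J / ∏ w_I` of the character `∑ e^{w_I} - ∑ e^{v_J}`. -/
def partitionFn (c : ExpSum k) (z : Params k) : ℂ :=
  c.prod fun w n => w z ^ (-n)

/-- The defect `ψ` obtained from the defect character `c`. -/
def defect (c : ExpSum k) (γ ħ : ℂ) (u : ∀ p : Fin M, Fin (k p.castSucc) → ℂ)
    (m : Fin (k (Fin.last M)) → ℂ) : ℂ :=
  sym (fun u' => partitionFn c (levels u' m, γ, ħ)) u

/-- The normalized defect: `ψ` times, for each node `p`,
`(-1)^{k_p k_{p+1} + ∑_a Ĩ⁽ᵖ⁾_a} ∏_{a<b} (γ² - (u⁽ᵖ⁾_a - u⁽ᵖ⁾_b)²)`. -/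
def NestedSets.normalizedDefect (I : NestedSets k) (c : ExpSum k) (γ ħ : ℂ)
    (u : ∀ p : Fin M, Fin (k p.castSucc) → ℂ) (m : Fin (k (Fin.last M)) → ℂ) : ℂ :=
  (∏ p : Fin M,
    (-1 : ℂ) ^ (k p.castSucc * k p.succ + ∑ a : Fin (k p.castSucc), ((I.tilde p a : ℕ) + 1)) *
      ∏ a : Fin (k p.castSucc), ∏ b ∈ Finset.Ioi a, (γ ^ 2 - (u p a - u p b) ^ 2)) *
    defect c γ ħ u m

/-! ### The symmetrized product of `su(2)` blocks -/

/-- The block `ω^{(L)}_I(u; v)`. -/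
def omega (γ : ℂ) {n L : ℕ} (I : Fin n → Fin L) (u : Fin n → ℂ) (v : Fin L → ℂ) : ℂ :=
  (∏ a : Fin n, (∏ i ∈ Finset.Iio (I a), (u a - v i - γ / 2)) *
      ∏ i ∈ Finset.Ioi (I a), (u a - v i + γ / 2)) *
    ∏ a : Fin n, ∏ b ∈ Finset.Ioi a, (u a - u b - γ) / (u a - u b)

/-- The symmetrization of the product of the blocks `ω^{(k_{p+1})}_{Ĩ⁽ᵖ⁾}(u⁽ᵖ⁾; u⁽ᵖ⁺¹⁾)`, the last
of which is `ω^{(L)}_{I⁽ᴹ⁾}(u⁽ᴹ⁾; m)`. -/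
def NestedSets.symOmega (I : NestedSets k) (γ : ℂ) (u : ∀ p : Fin M, Fin (k p.castSucc) → ℂ)
    (m : Fin (k (Fin.last M)) → ℂ) : ℂ :=
  sym (fun u' => ∏ p : Fin M,
    omega γ (I.tilde p) (levels u' m p.castSucc) (levels u' m p.succ)) u

/-! ### The nested coordinate Bethe wavefunction -/

/-- The amplitude `∏_{a<b} (u_a - u_b - γ) / (u_a - u_b)` of an ordered set of rapidities, which
encodes the two-body scattering. -/
def amplitude (γ : ℂ) {n : ℕ} (u : Fin n → ℂ) : ℂ :=
  ∏ a : Fin n, ∏ b ∈ Finset.Ioi a, (u a - u b - γ) / (u a - u b)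

/-- The one-particle wavefunction of rapidity `x` at position `s` of the chain with
inhomogeneities `v`. -/
def oneParticle (γ : ℂ) {n : ℕ} (v : Fin n → ℂ) (x : ℂ) (s : Fin n) : ℂ :=
  1 / (x - v s + γ / 2) * ∏ i ∈ Finset.Iio s, (x - v i - γ / 2) / (x - v i + γ / 2)

/-- The nested coordinate Bethe wavefunction. The excitations at the outermost level sit at the
positions `J (Fin.last M)` of the chain with inhomogeneities `m`; the wavefunction is the sum over
the permutations of their rapidities of amplitude times one-particle wavefunctions times the
wavefunction of the internal state of the excitations. The latter is the nested wavefunction with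
one level fewer of the chain formed by the excitations, whose inhomogeneities are their permuted
rapidities. -/
def nestedBethe (γ : ℂ) : ∀ {M : ℕ} (k : Fin (M + 1) → ℕ)
    (_ : ∀ p : Fin M, Fin (k p.castSucc) → Fin (k p.succ))
    (_ : ∀ p : Fin M, Fin (k p.castSucc) → ℂ) (_ : Fin (k (Fin.last M)) → ℂ), ℂ
  | 0, _, _, _, _ => 1
  | M + 1, k, J, u, m =>
    ∑ σ : Equiv.Perm (Fin (k (Fin.last M).castSucc)),
      amplitude γ (fun a => u (Fin.last M) (σ a)) *
        (∏ a, oneParticle γ m (u (Fin.last M) (σ a)) (J (Fin.last M) a)) *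
        nestedBethe γ (fun p : Fin (M + 1) => k p.castSucc) (fun p => J p.castSucc)
          (fun p => u p.castSucc) (fun a => u (Fin.last M) (σ a))

/-! ### The rational vertex model -/

/-- The weight of a vertex on a horizontal line with variable `x` and a vertical line with variable
`y`, with given colours of its four bonds: `a = x - y + 1` if all colours are equal, `b = x - y` if
two distinct colours go straight, `c = 1` if two distinct colours turn. -/
def vertexWeight {n : ℕ} (x y : ℂ) (left bottom right top : Fin n) : ℂ :=
  if left = bottom ∧ right = left ∧ top = left then x - y + 1
  else if left = right ∧ bottom = top then x - y
  else if left = top ∧ bottom = right then 1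
  else 0

/-- Colourings of the bonds of the lattice made of one rectangular block for each gauge node.
The block of node `p` has `k_p` horizontal lines, numbered from top to bottom, and `k_{p+1}`
vertical lines, numbered from left to right (`L` of them at the last node).

* `link (p+1) b` is the colour of the top bond of the `b`-th vertical line of block `p`. This bond is
  the left bond of the `b`-th horizontal line of the next block. `link 0` are the left bonds of the
  first block.
* `hor p a j` is the bond on the `a`-th horizontal line of block `p` to the left of the `j`-th
  vertical line (on the right boundary if `j = k_{p+1}`).
* `ver p j b` is the bond on the `b`-th vertical line of block `p` above the `j`-th horizontal
  line (on the lower boundary if `j = k_p`). -/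
@[ext] structure Colouring {M : ℕ} (k : Fin (M + 1) → ℕ) where
  link : ∀ p : Fin (M + 1), Fin (k p) → Fin (M + 1)
  hor : ∀ p : Fin M, Fin (k p.castSucc) → Fin (k p.succ + 1) → Fin (M + 1)
  ver : ∀ p : Fin M, Fin (k p.castSucc + 1) → Fin (k p.succ) → Fin (M + 1)

instance : Finite (Colouring k) :=
  Finite.of_injective (fun s : Colouring k => (s.link, s.hor, s.ver)) fun s t h => by
    simp only [Prod.mk.injEq] at h
    exact Colouring.ext h.1 h.2.1 h.2.2

instance : Fintype (Colouring k) := Fintype.ofFinite _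

/-- The boundary conditions: colour `1` on the left boundary of the first block, colour `p + 1` on
the right and lower boundaries of the block of the `p`-th node, colours `i` on the top boundary of
the last block, and top bonds of each block joined to left bonds of the next one. -/
structure Colouring.IsConfig (s : Colouring k) (i : Fin (k (Fin.last M)) → Fin (M + 1)) :
    Prop where
  first : ∀ a, s.link 0 a = 0
  last : ∀ l, s.link (Fin.last M) l = i l
  left : ∀ p a, s.hor p a 0 = s.link p.castSucc a
  right : ∀ p a, s.hor p a (Fin.last _) = p.succ
  top : ∀ p b, s.ver p 0 b = s.link p.succ b
  bottom : ∀ p b, s.ver p (Fin.last _) b = p.succ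

/-- The product of the weights of all vertices. The lines of the level `p` carry the variables
`x p`; those of the last level, which are only vertical, carry the inhomogeneities. -/
def Colouring.weight (s : Colouring k) (x : ∀ p : Fin (M + 1), Fin (k p) → ℂ) : ℂ :=
  ∏ p : Fin M, ∏ a : Fin (k p.castSucc), ∏ b : Fin (k p.succ),
    vertexWeight (x p.castSucc a) (x p.succ b)
      (s.hor p a b.castSucc) (s.ver p a.succ b) (s.hor p a b.succ) (s.ver p a.castSucc b)

open Classical in
/-- The partition function of the vertex model with rapidities `x`, inhomogeneities `y` and top
boundary colours `i`. -/
def latticePartitionFn (i : Fin (k (Fin.last M)) → Fin (M + 1))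
    (x : ∀ p : Fin M, Fin (k p.castSucc) → ℂ) (y : Fin (k (Fin.last M)) → ℂ) : ℂ :=
  ∑ s : Colouring k with s.IsConfig i, s.weight (levels x y)

end AMQuiver

end

/-! The defect character comes from averaging one monomial at a time. After the orbifold
substitution every term is $e^{A+d\hbar/L}/(1-e^{\hbar/L})$ with $-L<d\le L$, and its average over
$L$-th roots of unity is $e^A/(1-e^\hbar)$, minus $e^A$ when $d>0$ (`average_exp`). Since $d$ is, up
to a shift by one for the adjoint, a difference of positions, its sign is governed by the order of
the index sets, and the surplus exponentials are exactly the factors of the blocks $\omega$.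
Uniqueness is Dedekind's independence of characters. Passing from $\psi$ to $\Omega$ is then
bookkeeping of signs, plus one cancellation of $u_{a,b}+\gamma$.

The Bethe form follows from peeling off the last node. Each $\omega$ is its product of
$u-v+\gamma/2$ over all pairs times the amplitude and one-particle factors, and that product ignores
permutations of the variables.

The vertex model needs a real argument. Each vertex is a rational R-matrix, diagonal part plus
permutation, so Yang–Baxter gives two facts, both phrased through `Exchange`, the relation between
permuting letters and permuting parameters. If the function fed into the left of a block satisfies
it, the block is symmetric in its horizontal parameters (`Exchange.blockFn_perm`); and the output of
any block satisfies it in the top colours and vertical parameters (`exchange_blockFn`). So nested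
blocks can be evaluated one at a time.

One block is evaluated by `blockFn_eq_sum`, inductively on its columns. A first column whose top has
the boundary colour $v$ is diagonal. Otherwise the block is a polynomial in $y_0$ of degree less
than the number of horizontal lines, hence determined by its values at $y_0=x_a$. By symmetry line
$a$ may be taken lowest; there its vertex is a pure permutation, the line freezes, and a block with
one row and one column fewer remains. Lagrange interpolation reassembles the values into a sum over
permutations. -/

noncomputable section

namespace AMQuiver

/-! ### Yang–Baxter relation for two horizontal lines -/

section Blocks

variable {C : Type*} [DecidableEq C]

/-- The weights of a vertex with `x - y = d`, left colour `l` and right colour `r`, as a matrix from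
the colours of the bottom bond to those of the top bond. -/
def vertexMatrix (d : ℂ) (l r : C) : Matrix C C ℂ := fun t b =>
  (if l = r ∧ b = t then d else 0) + if l = t ∧ b = r then 1 else 0

lemma vertexMatrix_eq (d : ℂ) (l r : C) :
    vertexMatrix d l r = (if l = r then d else 0) • (1 : Matrix C C ℂ) + Matrix.single l r 1 := by
  ext t b
  by_cases h : l = r <;> by_cases h' : t = b <;> simp_all [vertexMatrix, Matrix.single, eq_comm]

variable [Fintype C]

/-- The weights of a column of vertices, from the colour of the bottom bond to that of the top
bond, with left colours `c` and right colours `e`. -/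
def column (y : ℂ) {k : ℕ} (x : Fin k → ℂ) (c e : Fin k → C) : Matrix C C ℂ :=
  (List.ofFn fun a => vertexMatrix (x a - y) (c a) (e a)).prod

lemma column_zero (y : ℂ) (x : Fin 0 → ℂ) (c e : Fin 0 → C) : column y x c e = 1 := by
  simp [column]

lemma column_succ (y : ℂ) {k : ℕ} (x : Fin (k + 1) → ℂ) (c e : Fin (k + 1) → C) :
    column y x c e = vertexMatrix (x 0 - y) (c 0) (e 0) *
      column y (fun a => x a.succ) (fun a => c a.succ) (fun a => e a.succ) := by
  simp [column, List.ofFn_succ]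

lemma column_succ_last (y : ℂ) {k : ℕ} (x : Fin (k + 1) → ℂ) (c e : Fin (k + 1) → C) :
    column y x c e =
      column y (fun a => x a.castSucc) (fun a => c a.castSucc) (fun a => e a.castSucc) *
        vertexMatrix (x (Fin.last k) - y) (c (Fin.last k)) (e (Fin.last k)) := by
  rw [column, List.ofFn_succ_last, List.prod_append, List.prod_singleton]
  rfl

/-- Yang–Baxter for two horizontal lines crossing one vertical line: $R=1+(x_1-x_2)P$ acts on the
left colours on one side and on the right colours on the other. -/
lemma vertexMatrix_exchange (x₁ x₂ : ℂ) (c₁ c₂ e₁ e₂ : C) :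
    vertexMatrix x₂ c₁ e₁ * vertexMatrix x₁ c₂ e₂ +
        (x₁ - x₂) • (vertexMatrix x₂ c₂ e₁ * vertexMatrix x₁ c₁ e₂) =
      vertexMatrix x₁ c₁ e₁ * vertexMatrix x₂ c₂ e₂ +
        (x₁ - x₂) • (vertexMatrix x₁ c₁ e₂ * vertexMatrix x₂ c₂ e₁) := by
  have key : ∀ a b c d : C, (Matrix.single a b (1 : ℂ)) * Matrix.single c d 1 =
      (if c = b then (1 : ℂ) else 0) • Matrix.single a d 1 := by
    intro a b c d
    split_ifs with h
    · subst h; simp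
    · rw [Matrix.single_mul_single_of_ne _ _ _ _ (Ne.symm h), zero_smul]
  have ite_mul' : ∀ (p : Prop) [Decidable p] (z : ℂ),
      (if p then z else 0) = z * if p then 1 else 0 := by intros; split_ifs <;> simp
  simp only [vertexMatrix_eq, add_mul, mul_add, smul_mul_assoc, mul_smul_comm, one_mul, mul_one, key]
  -- With $x_1,x_2$ outside the conditionals, the indicators are atoms for `module`.
  simp only [ite_mul' (_ = _) x₁, ite_mul' (_ = _) x₂]
  module

/-- The vertices above and below the two adjacent lines are common factors, so the relation for two
vertices suffices. -/
lemma column_exchange (y : ℂ) {k : ℕ} (x : Fin k → ℂ) (c e : Fin k → C) (i j : Fin k)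
    (hij : (j : ℕ) = i + 1) :
    column y (x ∘ Equiv.swap i j) c e +
        (x i - x j) • column y (x ∘ Equiv.swap i j) (c ∘ Equiv.swap i j) e =
      column y x c e + (x i - x j) • column y x c (e ∘ Equiv.swap i j) := by
  induction k with
  | zero => exact i.elim0
  | succ k ih =>
    obtain ⟨j, rfl⟩ : ∃ j', j = Fin.succ j' := Fin.exists_succ_eq.2 (by
      rintro rfl; simp at hij) |>.imp fun _ h => h.symm
    induction i using Fin.cases with
    | zero =>
      cases k with
      | zero => exact j.elim0
      | succ k =>
        obtain rfl : j = 0 := by ext; simpa using hij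
        have hs : ∀ a : Fin k, Equiv.swap (0 : Fin (k + 2)) 1 a.succ.succ = a.succ.succ := fun a =>
          Equiv.swap_apply_of_ne_of_ne (Fin.succ_ne_zero _)
            (by simp [Fin.ext_iff])
        have h := vertexMatrix_exchange (x 0 - y) (x 1 - y) (c 0) (c 1) (e 0) (e 1)
        rw [sub_sub_sub_cancel_right] at h
        have h' := congrArg (· * column y (fun a => x a.succ.succ) (fun a : Fin k => c a.succ.succ)
          (fun a => e a.succ.succ)) h
        simp only [column_succ, Function.comp_apply, Fin.succ_zero_eq_one, Equiv.swap_apply_left,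
          Equiv.swap_apply_right, hs]
        simpa only [add_mul, smul_mul_assoc, mul_assoc] using h'
    | succ i =>
      have hs0 : Equiv.swap i.succ j.succ 0 = 0 :=
        Equiv.swap_apply_of_ne_of_ne (Fin.succ_ne_zero _).symm (Fin.succ_ne_zero _).symm
      have hs : ∀ a : Fin k, Equiv.swap i.succ j.succ a.succ = (Equiv.swap i j a).succ := fun a =>
        ((Fin.succ_injective k).swap_apply i j a)
      have h := ih (fun a => x a.succ) (fun a => c a.succ) (fun a => e a.succ) i j (by simpa using hij)
      simp only [column_succ (C := C), Function.comp_apply, hs0, hs]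
      simp only [← mul_smul_comm, ← mul_add]
      exact congrArg _ h

/-- The action on words of a column of the block with bottom colour `v` and top colour `t`. -/
def transfer (v t : C) (y : ℂ) {k : ℕ} (x : Fin k → ℂ) (f : (Fin k → C) → ℂ) (e : Fin k → C) : ℂ :=
  ∑ c, f c * column y x c e t v

/-- The block with right and bottom colours `v` and top colours `i`, contracted with a function `f`
of the left colours. -/
def blockFn (v : C) {k : ℕ} (x : Fin k → ℂ) :
    ∀ {L : ℕ}, (Fin L → ℂ) → (Fin L → C) → ((Fin k → C) → ℂ) → ℂ
  | 0, _, _, f => f fun _ => v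
  | _ + 1, y, i, f =>
    blockFn v x (fun a => y a.succ) (fun a => i a.succ) (transfer v (i 0) (y 0) x f)

lemma transfer_sum (v t : C) (y : ℂ) {k : ℕ} (x : Fin k → ℂ) {ι : Type*} (s : Finset ι) (z : ι → ℂ)
    (f : ι → (Fin k → C) → ℂ) :
    transfer v t y x (fun c => ∑ n ∈ s, z n * f n c) =
      fun c => ∑ n ∈ s, z n * transfer v t y x (f n) c := by
  ext e
  simp only [transfer, Finset.sum_mul, Finset.mul_sum]
  rw [Finset.sum_comm]
  simp only [mul_assoc]

lemma blockFn_sum (v : C) {k : ℕ} (x : Fin k → ℂ) {L : ℕ} (y : Fin L → ℂ) (i : Fin L → C)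
    {ι : Type*} (s : Finset ι) (z : ι → ℂ) (f : ι → (Fin k → C) → ℂ) :
    blockFn v x y i (fun c => ∑ n ∈ s, z n * f n c) = ∑ n ∈ s, z n * blockFn v x y i (f n) := by
  induction L generalizing f with
  | zero => rfl
  | succ L ih => simp only [blockFn, transfer_sum, ih]

lemma blockFn_smul (v : C) {k : ℕ} (x : Fin k → ℂ) {L : ℕ} (y : Fin L → ℂ) (i : Fin L → C)
    (z : ℂ) (f : (Fin k → C) → ℂ) :
    blockFn v x y i (fun c => z * f c) = z * blockFn v x y i f := by
  simpa using blockFn_sum v x y i {()} (fun _ => z) (fun _ => f)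

lemma blockFn_add_smul (v : C) {k : ℕ} (x : Fin k → ℂ) {L : ℕ} (y : Fin L → ℂ) (i : Fin L → C)
    (z : ℂ) (f g : (Fin k → C) → ℂ) :
    blockFn v x y i (fun c => f c + z * g c) = blockFn v x y i f + z * blockFn v x y i g := by
  simpa using blockFn_sum v x y i Finset.univ ![1, z] ![f, g]

/-- The exchange relation of adjacent letters and of their parameters. -/
def Exchange {k : ℕ} (f : (Fin k → C) → (Fin k → ℂ) → ℂ) : Prop :=
  ∀ (i j : Fin k), (j : ℕ) = i + 1 → ∀ c x,
    (x i - x j + 1) * f c (x ∘ Equiv.swap i j) = f c x + (x i - x j) * f (c ∘ Equiv.swap i j) x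

/-- The R-matrix passes from the left to the right of a column. Here `f` and `f'` stand for the
values at `x` and at the swapped `x`; keeping them independent lets the statement be iterated over
columns. -/
lemma transfer_exchange (v t : C) (y : ℂ) {k : ℕ} (x : Fin k → ℂ) (i j : Fin k)
    (hij : (j : ℕ) = i + 1) (f f' : (Fin k → C) → ℂ)
    (h : ∀ c, (x i - x j + 1) * f' c = f c + (x i - x j) * f (c ∘ Equiv.swap i j)) (e : Fin k → C) :
    (x i - x j + 1) * transfer v t y (x ∘ Equiv.swap i j) f' e =
      transfer v t y x f e + (x i - x j) * transfer v t y x f (e ∘ Equiv.swap i j) := by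
  have h1 : ∑ c, f (c ∘ Equiv.swap i j) * column y (x ∘ Equiv.swap i j) c e t v =
      ∑ c, f c * column y (x ∘ Equiv.swap i j) (c ∘ Equiv.swap i j) e t v :=
    Fintype.sum_equiv (Equiv.arrowCongr (Equiv.swap i j) (Equiv.refl C)) _ _ fun c => by
      simp only [Equiv.arrowCongr, Equiv.coe_fn_mk, Equiv.coe_refl, Function.id_comp,
        Equiv.symm_swap]
      congr 3
      ext a
      simp
  have h2 : ∀ c, column y (x ∘ Equiv.swap i j) c e t v + (x i - x j) *
      column y (x ∘ Equiv.swap i j) (c ∘ Equiv.swap i j) e t v =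
      column y x c e t v + (x i - x j) * column y x c (e ∘ Equiv.swap i j) t v := fun c => by
    have := congrFun (congrFun (column_exchange y x c e i j hij) t) v
    simpa using this
  calc _ = ∑ c, (f c + (x i - x j) * f (c ∘ Equiv.swap i j)) *
        column y (x ∘ Equiv.swap i j) c e t v := by
        rw [transfer, Finset.mul_sum]; simp only [← mul_assoc, h]
    _ = ∑ c, f c * (column y (x ∘ Equiv.swap i j) c e t v + (x i - x j) *
      column y (x ∘ Equiv.swap i j) (c ∘ Equiv.swap i j) e t v) := by
        simp only [add_mul, mul_add, Finset.sum_add_distrib, mul_assoc, ← Finset.mul_sum, h1]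
        simp only [mul_left_comm _ (x i - x j), ← Finset.mul_sum]
    _ = _ := by
        simp only [h2, transfer, mul_add, Finset.sum_add_distrib, Finset.mul_sum]
        simp only [mul_left_comm _ (x i - x j)]

/-- Once pushed to the right boundary, where all colours are `v`, the R-matrix is the scalar
$x_i-x_j+1$. -/
lemma blockFn_exchange (v : C) {k : ℕ} (x : Fin k → ℂ) (i j : Fin k)
    (hij : (j : ℕ) = i + 1) {L : ℕ} (y : Fin L → ℂ) (w : Fin L → C) (f f' : (Fin k → C) → ℂ)
    (h : ∀ c, (x i - x j + 1) * f' c = f c + (x i - x j) * f (c ∘ Equiv.swap i j)) :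
    (x i - x j + 1) * blockFn v (x ∘ Equiv.swap i j) y w f' =
      (x i - x j + 1) * blockFn v x y w f := by
  induction L generalizing f f' with
  | zero =>
    rw [blockFn, blockFn, h]
    have : (fun _ : Fin k => v) ∘ Equiv.swap i j = fun _ => v := rfl
    rw [this]; ring
  | succ L ih => exact ih _ _ _ _ (transfer_exchange v (w 0) (y 0) x i j hij f f' h)

lemma Exchange.blockFn_swap {k : ℕ} {f : (Fin k → C) → (Fin k → ℂ) → ℂ} (hf : Exchange f) (v : C)
    (i j : Fin k) (hij : (j : ℕ) = i + 1) {L : ℕ} (y : Fin L → ℂ) (w : Fin L → C) (x : Fin k → ℂ) :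
    blockFn v (x ∘ Equiv.swap i j) y w (fun c => f c (x ∘ Equiv.swap i j)) =
      blockFn v x y w fun c => f c x := by
  -- When this scalar vanishes, the same relation read from the swapped parameters has the scalar
  -- $x_j-x_i+1=2$.
  by_cases hd : x i - x j + 1 = 0
  · have h := blockFn_exchange v (x ∘ Equiv.swap i j) i j hij y w
      (fun c => f c (x ∘ Equiv.swap i j)) (fun c => f c x) fun c => by
        have := hf i j hij c (x ∘ Equiv.swap i j)
        have h2 : (x ∘ Equiv.swap i j) ∘ Equiv.swap i j = x := by ext a; simp
        rwa [h2] at this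
    have h2 : (x ∘ Equiv.swap i j) ∘ Equiv.swap i j = x := by ext a; simp
    rw [h2] at h
    refine (mul_left_cancel₀ ?_ h).symm
    simp only [Function.comp_apply, Equiv.swap_apply_left, Equiv.swap_apply_right]
    intro h3
    have : (2 : ℂ) = 0 := by linear_combination hd + h3
    norm_num at this
  · exact mul_left_cancel₀ hd (blockFn_exchange v x i j hij y w _ _ fun c => hf i j hij c x)

lemma Exchange.blockFn_perm {k : ℕ} {f : (Fin k → C) → (Fin k → ℂ) → ℂ} (hf : Exchange f) (v : C)
    {L : ℕ} (y : Fin L → ℂ) (w : Fin L → C) (σ : Equiv.Perm (Fin k)) (x : Fin k → ℂ) :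
    blockFn v (x ∘ σ) y w (fun c => f c (x ∘ σ)) = blockFn v x y w fun c => f c x := by
  cases k with
  | zero => congr 1; (ext a; exact a.elim0); ext; congr 1; ext a; exact a.elim0
  | succ n =>
    have hσ : σ ∈ Submonoid.closure
        (Set.range fun i : Fin n => Equiv.swap i.castSucc i.succ) := by
      rw [Equiv.Perm.mclosure_swap_castSucc_succ]; trivial
    induction hσ using Submonoid.closure_induction generalizing x with
    | mem τ hτ =>
      obtain ⟨i, rfl⟩ := hτ
      exact hf.blockFn_swap v _ _ (by simp) y w x
    | one => rfl
    | mul σ τ _ _ hσ hτ =>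
      rw [Equiv.Perm.coe_mul, ← Function.comp_assoc, hτ (x ∘ σ), hσ]

end Blocks

/-! ### Yang–Baxter relation for two adjacent columns -/

section Blocks

variable {C : Type*} [DecidableEq C] [Fintype C]

omit [DecidableEq C] in
lemma sum_word_cons {k : ℕ} {R : Type*} [AddCommMonoid R] (F : (Fin (k + 1) → C) → R) :
    ∑ c, F c = ∑ a, ∑ c : Fin k → C, F (Fin.cons a c) := by
  rw [← (Fin.consEquiv fun _ => C).sum_comp, Fintype.sum_prod_type]
  rfl

omit [DecidableEq C] in
lemma sum_word_snoc {k : ℕ} {R : Type*} [AddCommMonoid R] (F : (Fin (k + 1) → C) → R) :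
    ∑ c, F c = ∑ c : Fin k → C, ∑ a, F (Fin.snoc c a) := by
  rw [← (Fin.snocEquiv fun _ => C).sum_comp, Fintype.sum_prod_type, Finset.sum_comm]
  rfl

open Kronecker

/-- Two vertices next to each other on a horizontal line. -/
def pairVertex (d₁ d₂ : ℂ) (l r : C) : Matrix (C × C) (C × C) ℂ :=
  ∑ e, vertexMatrix d₁ l e ⊗ₖ vertexMatrix d₂ e r

/-- Two adjacent columns. -/
def pairColumn (y₁ y₂ : ℂ) {k : ℕ} (x : Fin k → ℂ) (c g : Fin k → C) : Matrix (C × C) (C × C) ℂ :=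
  ∑ e, column y₁ x c e ⊗ₖ column y₂ x e g

variable (C) in
/-- The permutation of two colours. -/
def swapMatrix : Matrix (C × C) (C × C) ℂ := fun p q => if q = p.swap then 1 else 0

lemma mul_swapMatrix_apply (A : Matrix (C × C) (C × C) ℂ) (p q : C × C) :
    (A * swapMatrix C) p q = A p q.swap := by
  simp [Matrix.mul_apply, swapMatrix, ← Prod.swap_eq_iff_eq_swap]

lemma swapMatrix_mul_apply (A : Matrix (C × C) (C × C) ℂ) (p q : C × C) :
    (swapMatrix C * A) p q = A p.swap q := by
  simp [Matrix.mul_apply, swapMatrix]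

/-- One term for each choice of going straight or turning at the two vertices; with the intermediate
colour summed out, the exchange relation becomes an identity for `ring`. -/
lemma pairVertex_apply (d₁ d₂ : ℂ) (l r t₁ t₂ b₁ b₂ : C) :
    pairVertex d₁ d₂ l r (t₁, t₂) (b₁, b₂) =
      d₁ * d₂ * ((if l = r then 1 else 0) * (if b₁ = t₁ then 1 else 0) * (if b₂ = t₂ then 1 else 0)) +
      d₁ * ((if b₁ = t₁ then 1 else 0) * (if l = t₂ then 1 else 0) * (if b₂ = r then 1 else 0)) +
      d₂ * ((if l = t₁ then 1 else 0) * (if b₁ = r then 1 else 0) * (if b₂ = t₂ then 1 else 0)) +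
      (if l = t₁ then 1 else 0) * (if b₁ = t₂ then 1 else 0) * (if b₂ = r then 1 else 0) := by
  have key : ∀ e : C, (vertexMatrix d₁ l e ⊗ₖ vertexMatrix d₂ e r) (t₁, t₂) (b₁, b₂) =
      (if l = e then (if b₁ = t₁ then d₁ else 0) *
        ((if l = r ∧ b₂ = t₂ then d₂ else 0) + if l = t₂ ∧ b₂ = r then 1 else 0) else 0) +
      (if b₁ = e then (if l = t₁ then 1 else 0) *
        ((if b₁ = r ∧ b₂ = t₂ then d₂ else 0) + if b₁ = t₂ ∧ b₂ = r then 1 else 0) else 0) := by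
    intro e
    rw [Matrix.kroneckerMap_apply, vertexMatrix, vertexMatrix]
    by_cases h1 : l = e <;> by_cases h2 : b₁ = e <;> simp [h1, h2, add_mul]
  rw [pairVertex, Matrix.sum_apply, Finset.sum_congr rfl fun e _ => key e,
    Finset.sum_add_distrib, Finset.sum_ite_eq, Finset.sum_ite_eq, if_pos (Finset.mem_univ _),
    if_pos (Finset.mem_univ _)]
  have h1 : ∀ (p q : Prop) [Decidable p] [Decidable q] (z : ℂ), (if p ∧ q then z else 0) =
      z * ((if p then 1 else 0) * if q then 1 else 0) := by intros; split_ifs <;> simp_all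
  have h2 : (if b₁ = t₁ then d₁ else 0) = d₁ * if b₁ = t₁ then 1 else 0 := by simp
  simp only [h1, h2]
  ring

lemma pairVertex_exchange (x y₁ y₂ : ℂ) (l r : C) :
    pairVertex (x - y₂) (x - y₁) l r * (1 + (y₁ - y₂) • swapMatrix C) =
      (1 + (y₁ - y₂) • swapMatrix C) * pairVertex (x - y₁) (x - y₂) l r := by
  ext ⟨t₁, t₂⟩ ⟨b₁, b₂⟩
  simp only [mul_add, add_mul, mul_one, one_mul, Matrix.add_apply, mul_smul_comm, smul_mul_assoc,
    Matrix.smul_apply, mul_swapMatrix_apply, swapMatrix_mul_apply, Prod.swap_prod_mk,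
    pairVertex_apply, smul_eq_mul]
  ring

lemma pairColumn_succ (y₁ y₂ : ℂ) {k : ℕ} (x : Fin (k + 1) → ℂ) (c g : Fin (k + 1) → C) :
    pairColumn y₁ y₂ x c g = pairVertex (x 0 - y₁) (x 0 - y₂) (c 0) (g 0) *
      pairColumn y₁ y₂ (fun a => x a.succ) (fun a => c a.succ) (fun a => g a.succ) := by
  rw [pairColumn, sum_word_cons, pairVertex, Matrix.sum_mul]
  refine Finset.sum_congr rfl fun a _ => ?_
  rw [pairColumn, Matrix.mul_sum]
  refine Finset.sum_congr rfl fun e _ => ?_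
  rw [column_succ, column_succ, Matrix.mul_kronecker_mul]
  simp

/-- The R-matrix of the two vertical lines slides through the rows one by one. -/
lemma pairColumn_exchange (y₁ y₂ : ℂ) {k : ℕ} (x : Fin k → ℂ) (c g : Fin k → C) :
    pairColumn y₂ y₁ x c g * (1 + (y₁ - y₂) • swapMatrix C) =
      (1 + (y₁ - y₂) • swapMatrix C) * pairColumn y₁ y₂ x c g := by
  induction k with
  | zero => simp [pairColumn, column_zero]
  | succ k ih =>
    rw [pairColumn_succ, pairColumn_succ, mul_assoc, ih, ← mul_assoc, pairVertex_exchange, mul_assoc]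

lemma transfer_transfer (v t₁ t₂ : C) (y₁ y₂ : ℂ) {k : ℕ} (x : Fin k → ℂ)
    (f : (Fin k → C) → ℂ) (g : Fin k → C) :
    transfer v t₂ y₂ x (transfer v t₁ y₁ x f) g =
      ∑ c, f c * pairColumn y₁ y₂ x c g (t₁, t₂) (v, v) := by
  simp only [transfer, pairColumn, Matrix.sum_apply, Matrix.kronecker_apply, Finset.sum_mul,
    Finset.mul_sum, mul_assoc]
  exact Finset.sum_comm

/-- At the bottom both colours are `v`, so the R-matrix is the scalar $y_1-y_2+1$; at the top it
permutes $t_1$ and $t_2$. -/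
lemma transfer_transfer_exchange (v t₁ t₂ : C) (y₁ y₂ : ℂ) {k : ℕ} (x : Fin k → ℂ)
    (f : (Fin k → C) → ℂ) (g : Fin k → C) :
    (y₁ - y₂ + 1) * transfer v t₂ y₁ x (transfer v t₁ y₂ x f) g =
      transfer v t₂ y₂ x (transfer v t₁ y₁ x f) g +
        (y₁ - y₂) * transfer v t₁ y₂ x (transfer v t₂ y₁ x f) g := by
  simp only [transfer_transfer, Finset.mul_sum, ← Finset.sum_add_distrib]
  refine Finset.sum_congr rfl fun c _ => ?_
  have h := congrFun (congrFun (pairColumn_exchange y₁ y₂ x c g) (t₁, t₂)) (v, v)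
  simp only [mul_add, add_mul, mul_one, one_mul, Matrix.add_apply, mul_smul_comm, smul_mul_assoc,
    Matrix.smul_apply, mul_swapMatrix_apply, swapMatrix_mul_apply, Prod.swap_prod_mk,
    smul_eq_mul] at h
  linear_combination f c * h

/-- No condition on `f` is needed. This makes the output of a block an admissible input of the next
one. -/
lemma exchange_blockFn (v : C) {k : ℕ} (x : Fin k → ℂ) (L : ℕ) (f : (Fin k → C) → ℂ) :
    Exchange fun (w : Fin L → C) y => blockFn v x y w f := by
  intro i j hij w y
  dsimp only
  induction L generalizing f with
  | zero => exact i.elim0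
  | succ L ih =>
    obtain ⟨j, rfl⟩ : ∃ j', j = Fin.succ j' := Fin.exists_succ_eq.2 (by
      rintro rfl; simp at hij) |>.imp fun _ h => h.symm
    induction i using Fin.cases with
    | zero =>
      cases L with
      | zero => exact j.elim0
      | succ L =>
        obtain rfl : j = 0 := by ext; simpa using hij
        have hs : ∀ a : Fin L, Equiv.swap (0 : Fin (L + 2)) 1 a.succ.succ = a.succ.succ := fun a =>
          Equiv.swap_apply_of_ne_of_ne (Fin.succ_ne_zero _)
            (by simp [Fin.ext_iff])
        simp only [blockFn, Function.comp_apply, Fin.succ_zero_eq_one, Equiv.swap_apply_left,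
          Equiv.swap_apply_right, hs]
        rw [← blockFn_smul, ← blockFn_add_smul]
        congr 1
        ext g
        exact transfer_transfer_exchange _ _ _ _ _ _ _ _
    | succ i =>
      have hs0 : Equiv.swap i.succ j.succ 0 = 0 :=
        Equiv.swap_apply_of_ne_of_ne (Fin.succ_ne_zero _).symm (Fin.succ_ne_zero _).symm
      have hs : ∀ a : Fin L, Equiv.swap i.succ j.succ a.succ = (Equiv.swap i j a).succ := fun a =>
        ((Fin.succ_injective L).swap_apply i j a)
      have h := ih (transfer v (w 0) (y 0) x f) i j (by simpa using hij) (fun a => w a.succ)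
        (fun a => y a.succ)
      simp only [blockFn, Function.comp_apply, hs0, hs]
      exact h

/-! ### Evaluation of a block -/

/-- A vertical line of colour `v` at its top can turn only where a `v` enters from the left. None
does, so every vertex is crossed straight. -/
lemma transfer_self (v : C) (y : ℂ) {k : ℕ} (x : Fin k → ℂ) (f : (Fin k → C) → ℂ)
    (hf : ∀ c a, c a = v → f c = 0) (e : Fin k → C) :
    transfer v v y x f e = (∏ a, (x a - y)) * f e := by
  have key : ∀ c : Fin k → C, (∀ a, c a ≠ v) →
      column y x c e v v = if c = e then ∏ a, (x a - y) else 0 := by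
    clear hf f
    intro c hc
    induction k with
    | zero => simp [column_zero, Subsingleton.elim c e]
    | succ k ih =>
      rw [column_succ, Matrix.mul_apply, Finset.sum_eq_single v]
      · rw [ih _ _ _ fun a => hc _, Fin.prod_univ_succ]
        by_cases h0 : c 0 = e 0
        · by_cases h1 : (fun a : Fin k => c a.succ) = fun a => e a.succ
          · have : c = e := by
              ext a; induction a using Fin.cases with
              | zero => exact h0
              | succ a => exact congrFun h1 a
            subst this
            simp [vertexMatrix, hc]
          · have : c ≠ e := fun h => h1 (by rw [h])
            simp [this, h1]
        · have : c ≠ e := fun h => h0 (by rw [h])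
          simp [vertexMatrix, this, h0, hc]
      · intro b _ hb
        simp [vertexMatrix, hc, hb]
      · simp
  rw [transfer, Finset.sum_eq_single e]
  · by_cases h : ∀ a, e a ≠ v
    · simp [key e h, mul_comm]
    · push Not at h
      obtain ⟨a, ha⟩ := h
      simp [hf e a ha]
  · intro c _ hce
    by_cases h : ∀ a, c a ≠ v
    · simp [key c h, hce]
    · push Not at h
      obtain ⟨a, ha⟩ := h
      simp [hf c a ha]
  · simp

open Polynomial

omit [Fintype C] in
lemma vertexMatrix_degreeLT (z : ℂ) (l r t b : C) :
    ∃ P ∈ degreeLT ℂ 2, ∀ y, vertexMatrix (z - y) l r t b = P.eval y := by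
  refine ⟨(if l = r ∧ b = t then Polynomial.C z - X else 0) +
    if l = t ∧ b = r then 1 else 0, ?_, fun y => ?_⟩
  · refine Submodule.add_mem _ ?_ ?_
    · split_ifs
      · rw [mem_degreeLT, ← neg_sub, degree_neg, degree_X_sub_C]; norm_num
      · exact zero_mem _
    · split_ifs
      · rw [mem_degreeLT, degree_one]; norm_num
      · exact zero_mem _
  · rw [vertexMatrix]; split_ifs <;> simp

lemma mul_mem_degreeLT {n : ℕ} {P Q : ℂ[X]} (hP : P ∈ degreeLT ℂ 2) (hQ : Q ∈ degreeLT ℂ n) :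
    P * Q ∈ degreeLT ℂ (n + 1) := by
  rw [mem_degreeLT] at *
  by_cases hQ0 : Q = 0
  · simp [hQ0]
  by_cases hP0 : P = 0
  · simp [hP0]
  rw [degree_mul, degree_eq_natDegree hP0, degree_eq_natDegree hQ0] at *
  norm_cast at *
  omega

lemma column_degreeLT_succ {k : ℕ} (x : Fin k → ℂ) (c e : Fin k → C) (t b : C) :
    ∃ P ∈ degreeLT ℂ (k + 1), ∀ y, column y x c e t b = P.eval y := by
  induction k generalizing t b with
  | zero =>
    refine ⟨if t = b then 1 else 0, ?_, fun y => ?_⟩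
    · split_ifs
      · rw [mem_degreeLT, degree_one]; norm_num
      · exact zero_mem _
    · rw [column_zero, Matrix.one_apply]; split_ifs <;> simp
  | succ k ih =>
    choose P hP hP' using ih (fun a => x a.succ) (fun a => c a.succ) (fun a => e a.succ)
    choose Q hQ hQ' using vertexMatrix_degreeLT (x 0) (c 0) (e 0)
    refine ⟨∑ s, Q t s * P s b, Submodule.sum_mem _ fun s _ => mul_mem_degreeLT (hQ t s) (hP s b),
      fun y => ?_⟩
    rw [column_succ, Matrix.mul_apply, eval_finsetSum]
    simp [hP', hQ']

/-- The vertical colour must change at some vertex, and that vertex has a constant weight; this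
lowers the degree bound by one. -/
lemma column_degreeLT {v t : C} (ht : t ≠ v) {k : ℕ} (x : Fin k → ℂ) (c e : Fin k → C) :
    ∃ P ∈ degreeLT ℂ k, ∀ y, column y x c e t v = P.eval y := by
  induction k generalizing t with
  | zero => exact ⟨0, zero_mem _, fun y => by simp [column_zero, ht]⟩
  | succ k ih =>
    have hone : ∀ s : C, ∃ P ∈ degreeLT ℂ (k + 1), ∀ y, vertexMatrix (x 0 - y) (c 0) (e 0) t s *
        column y (fun a => x a.succ) (fun a => c a.succ) (fun a => e a.succ) s v = P.eval y := by
      intro s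
      by_cases hs : s = v
      · subst hs
        obtain ⟨P, hP, hP'⟩ := column_degreeLT_succ (fun a => x a.succ) (fun a => c a.succ)
          (fun a => e a.succ) s s
        refine ⟨(if c 0 = t ∧ s = e 0 then 1 else 0 : ℂ) • P, Submodule.smul_mem _ _ hP, fun y => ?_⟩
        rw [hP', vertexMatrix, if_neg (fun h => ht h.2.symm), eval_smul, smul_eq_mul, zero_add]
      · obtain ⟨P, hP, hP'⟩ := ih hs (fun a => x a.succ) (fun a => c a.succ) (fun a => e a.succ)
        obtain ⟨Q, hQ, hQ'⟩ := vertexMatrix_degreeLT (x 0) (c 0) (e 0) t s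
        exact ⟨Q * P, mul_mem_degreeLT hQ hP, fun y => by simp [hP', hQ']⟩
    choose P hP hP' using hone
    refine ⟨∑ s, P s, Submodule.sum_mem _ fun s _ => hP s, fun y => ?_⟩
    rw [column_succ, Matrix.mul_apply, eval_finsetSum]
    simp [hP']

end Blocks

/-! ### Freezing at coinciding parameters, and interpolation -/

section Blocks

variable {C : Type*} [DecidableEq C] [Fintype C]

omit [Fintype C] [DecidableEq C] in
lemma Exchange.cons {k : ℕ} {f : (Fin (k + 1) → C) → (Fin (k + 1) → ℂ) → ℂ} (hf : Exchange f)
    (t : C) (z : ℂ) : Exchange fun (c : Fin k → C) x => f (Fin.cons t c) (Fin.cons z x) := by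
  intro i j hij c x
  have h := hf i.succ j.succ (by simpa using hij) (Fin.cons t c) (Fin.cons z x)
  have h1 : (Fin.cons t c : Fin (k + 1) → C) ∘ Equiv.swap i.succ j.succ =
    Fin.cons t (c ∘ Equiv.swap i j) := (Matrix.cons_swap t c i j).symm
  have h2 : (Fin.cons z x : Fin (k + 1) → ℂ) ∘ Equiv.swap i.succ j.succ =
    Fin.cons z (x ∘ Equiv.swap i j) := (Matrix.cons_swap z x i j).symm
  rwa [h1, h2, Fin.cons_succ, Fin.cons_succ] at h

/-- The function of words that forces the last letter to be `v`. -/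
def freezeLast (v : C) {k : ℕ} (F : (Fin k → C) → ℂ) (c : Fin (k + 1) → C) : ℂ :=
  if c (Fin.last k) = v then F fun a => c a.castSucc else 0

/-- A vertex with left and bottom colours `v` has all its colours `v`, so the lowest line only
contributes a scalar. -/
lemma transfer_freezeLast (v t : C) (y : ℂ) {k : ℕ} (x : Fin (k + 1) → ℂ) (F : (Fin k → C) → ℂ) :
    transfer v t y x (freezeLast v F) = fun e => (x (Fin.last k) - y + 1) *
      freezeLast v (transfer v t y (fun a => x a.castSucc) F) e := by
  ext e
  rw [transfer, sum_word_snoc]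
  simp only [freezeLast, Fin.snoc_last, Fin.snoc_castSucc, column_succ_last, Matrix.mul_apply,
    transfer, ite_mul, zero_mul, Finset.sum_ite_eq', Finset.mem_univ, if_true]
  have : ∀ s, vertexMatrix (x (Fin.last k) - y) v (e (Fin.last k)) s v =
      if v = s then (if e (Fin.last k) = v then x (Fin.last k) - y + 1 else 0) else 0 := by
    intro s
    rw [vertexMatrix]
    by_cases h2 : v = s
    · subst h2
      by_cases h1 : v = e (Fin.last k)
      · simp [← h1]
      · simp [h1, Ne.symm h1]
    · simp [h2]
  simp only [this, mul_ite, mul_zero, Finset.sum_ite_eq, Finset.mem_univ, if_true]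
  split_ifs
  · rw [Finset.mul_sum]; exact Finset.sum_congr rfl fun c _ => by ring
  · simp

lemma blockFn_freezeLast (v : C) {k : ℕ} (x : Fin (k + 1) → ℂ) {L : ℕ} (y : Fin L → ℂ)
    (i : Fin L → C) (F : (Fin k → C) → ℂ) :
    blockFn v x y i (freezeLast v F) = (∏ l, (x (Fin.last k) - y l + 1)) *
      blockFn v (fun a => x a.castSucc) y i F := by
  induction L generalizing F with
  | zero => simp [blockFn, freezeLast]
  | succ L ih =>
    rw [blockFn, transfer_freezeLast, blockFn_smul, ih, Fin.prod_univ_succ, blockFn, mul_assoc]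

/-- Each vertex of a column with parameter `z` is the operator on the right of `Exchange`, so the
column carries the pair of `z` and its letter from the last place to the first, with a factor
$x_b-z+1$ for each line crossed. -/
lemma Exchange.sum_snoc {k : ℕ} {f : (Fin (k + 1) → C) → (Fin (k + 1) → ℂ) → ℂ} (hf : Exchange f)
    (x : Fin k → ℂ) (z : ℂ) (e : Fin k → C) (t : C) :
    ∑ c : Fin k → C, ∑ d, f (Fin.snoc c d) (Fin.snoc x z) * column z x c e t d =
      (∏ b, (x b - z + 1)) * f (Fin.cons t e) (Fin.cons z x) := by
  induction k generalizing t with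
  | zero =>
    simp only [column_zero, Matrix.one_apply, mul_ite, mul_one, mul_zero, Finset.sum_ite_eq,
      Finset.mem_univ, if_true, Finset.univ_eq_empty, Finset.prod_empty, one_mul,
      Fintype.sum_unique]
    congr 1 <;> (ext a; induction a using Fin.cases with | zero => rfl | succ a => exact a.elim0)
  | succ k ih =>
    obtain ⟨x0, x, rfl⟩ : ∃ x0 x', x = Fin.cons x0 x' := ⟨x 0, Fin.tail x, (Fin.cons_self_tail x).symm⟩
    obtain ⟨e0, e, rfl⟩ : ∃ e0 e', e = Fin.cons e0 e' := ⟨e 0, Fin.tail e, (Fin.cons_self_tail e).symm⟩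
    have step : ∀ c0 b, ∑ c : Fin k → C, ∑ d,
        f (Fin.cons c0 (Fin.snoc c d)) (Fin.cons x0 (Fin.snoc x z)) * column z x c e b d =
        (∏ b, (x b - z + 1)) * f (Fin.cons c0 (Fin.cons b e)) (Fin.cons x0 (Fin.cons z x)) :=
      fun c0 b => ih (hf.cons c0 x0) x e b
    have hx := hf 0 1 rfl (Fin.cons t (Fin.cons e0 e)) (Fin.cons x0 (Fin.cons z x))
    have h1 : (Fin.cons t (Fin.cons e0 e) : Fin (k + 2) → C) ∘ Equiv.swap 0 1 =
      Fin.cons e0 (Fin.cons t e) := Matrix.cons_cons_comp_swap_zero_one t e0 e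
    have h2 : (Fin.cons x0 (Fin.cons z x) : Fin (k + 2) → ℂ) ∘ Equiv.swap 0 1 =
      Fin.cons z (Fin.cons x0 x) := Matrix.cons_cons_comp_swap_zero_one x0 z x
    rw [h1, h2] at hx
    simp only [Fin.cons_zero, Fin.cons_one] at hx
    rw [sum_word_cons]
    simp only [column_succ, Fin.cons_zero, Fin.cons_succ, ← Fin.cons_snoc_eq_snoc_cons,
      Matrix.mul_apply]
    calc _ = ∑ c0, ∑ b, vertexMatrix (x0 - z) c0 e0 t b * ∑ c : Fin k → C, ∑ d,
          f (Fin.cons c0 (Fin.snoc c d)) (Fin.cons x0 (Fin.snoc x z)) * column z x c e b d := by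
          refine Finset.sum_congr rfl fun c0 _ => ?_
          simp only [Finset.mul_sum]
          rw [Finset.sum_congr rfl fun c _ => Finset.sum_comm, Finset.sum_comm]
          refine Finset.sum_congr rfl fun b _ => Finset.sum_congr rfl fun c _ =>
            Finset.sum_congr rfl fun d _ => by ring
      _ = (∏ b, (x b - z + 1)) * ((x0 - z) * f (Fin.cons e0 (Fin.cons t e))
            (Fin.cons x0 (Fin.cons z x)) + f (Fin.cons t (Fin.cons e0 e))
            (Fin.cons x0 (Fin.cons z x))) := by
          simp only [step, vertexMatrix, add_mul, Finset.sum_add_distrib, mul_add, ite_and, ite_mul,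
            zero_mul, one_mul, Finset.sum_ite_eq', Finset.mem_univ, if_true,
            Finset.sum_ite_irrel, Finset.sum_const_zero]
          ring
      _ = _ := by
          rw [Fin.prod_univ_succ]
          simp only [Fin.cons_zero, Fin.cons_succ]
          linear_combination (-∏ b, (x b - z + 1)) * hx

/-- At $y=x_{\mathrm{last}}$ the lowest vertex always turns: the last letter goes up into the
column, where `Exchange.sum_snoc` applies, and the bottom colour `v` leaves to the right. -/
lemma Exchange.transfer_last {k : ℕ} {f : (Fin (k + 1) → C) → (Fin (k + 1) → ℂ) → ℂ}
    (hf : Exchange f) (v t : C) (x : Fin (k + 1) → ℂ) :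
    transfer v t (x (Fin.last k)) x (fun c => f c x) = freezeLast v fun e =>
      (∏ b : Fin k, (x b.castSucc - x (Fin.last k) + 1)) *
        f (Fin.cons t e) (Fin.cons (x (Fin.last k)) fun a => x a.castSucc) := by
  ext e
  obtain ⟨x, z, rfl⟩ : ∃ (x' : Fin k → ℂ) (z : ℂ), x = Fin.snoc x' z :=
    ⟨Fin.init x, x (Fin.last k), (Fin.snoc_init_self x).symm⟩
  rw [transfer, sum_word_snoc]
  simp only [freezeLast, Fin.snoc_last, Fin.snoc_castSucc, column_succ_last, Matrix.mul_apply]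
  rw [← hf.sum_snoc]
  have : ∀ d s, vertexMatrix (z - z) d (e (Fin.last k)) s v =
      if d = s then (if e (Fin.last k) = v then 1 else 0) else 0 := by
    intro d s
    rw [vertexMatrix]
    by_cases h1 : e (Fin.last k) = v <;> by_cases h2 : d = s <;> simp [h1, h2, eq_comm]
    · intro h; exact absurd h.symm h1
  simp only [this, mul_ite, mul_zero, Finset.sum_ite_eq, Finset.mem_univ, if_true]
  split_ifs <;> simp

lemma Exchange.blockFn_zero_eq_last {k : ℕ} {f : (Fin (k + 1) → C) → (Fin (k + 1) → ℂ) → ℂ}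
    (hf : Exchange f) (v : C) (x : Fin (k + 1) → ℂ) {L : ℕ} (y : Fin L → ℂ) (i : Fin (L + 1) → C) :
    blockFn v x (Fin.cons (x (Fin.last k)) y) i (fun c => f c x) =
      (∏ b : Fin k, (x b.castSucc - x (Fin.last k) + 1)) * (∏ l, (x (Fin.last k) - y l + 1)) *
        blockFn v (fun a => x a.castSucc) y (fun l => i l.succ) fun c =>
          f (Fin.cons (i 0) c) (Fin.cons (x (Fin.last k)) fun a => x a.castSucc) := by
  rw [blockFn, Fin.cons_zero, hf.transfer_last, blockFn_freezeLast, blockFn_smul]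
  simp only [Fin.cons_succ]
  ring

lemma prod_erase_eq_prod_swap {k : ℕ} (a : Fin (k + 1)) (g : Fin (k + 1) → ℂ) :
    ∏ j ∈ Finset.univ.erase a, g j = ∏ b : Fin k, g (Equiv.swap 0 a b.succ) := by
  have : ∏ j ∈ Finset.univ.erase a, g j = ∏ j, if j = a then 1 else g j := by
    rw [← Finset.mul_prod_erase _ _ (Finset.mem_univ a), if_pos rfl, one_mul]
    exact Finset.prod_congr rfl fun j hj => (if_neg (Finset.ne_of_mem_erase hj)).symm
  rw [this, ← Equiv.prod_comp (Equiv.swap 0 a), Fin.prod_univ_succ, Equiv.swap_apply_left,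
    if_pos rfl, one_mul]
  refine Finset.prod_congr rfl fun b _ => if_neg fun h => ?_
  rw [Equiv.swap_apply_eq_iff, Equiv.swap_apply_right] at h
  exact Fin.succ_ne_zero _ h

-- Lagrange interpolation, with the nodes other than $x_a$ enumerated as in
-- `Equiv.Perm.decomposeFin`.
open Polynomial in
lemma eval_eq_sum_swap {k : ℕ} {P : ℂ[X]} (hP : P ∈ degreeLT ℂ (k + 1)) {x : Fin (k + 1) → ℂ}
    (hx : Function.Injective x) (y : ℂ) :
    P.eval y = ∑ a, P.eval (x a) * ∏ b : Fin k,
      ((y - x (Equiv.swap 0 a b.succ)) / (x a - x (Equiv.swap 0 a b.succ))) := by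
  conv_lhs => rw [Lagrange.eq_interpolate (f := P) (s := Finset.univ) (v := x) hx.injOn
    (by simpa [mem_degreeLT] using hP)]
  rw [Lagrange.interpolate_apply, eval_finsetSum]
  refine Finset.sum_congr rfl fun a _ => ?_
  rw [eval_mul, eval_C, Lagrange.basis, eval_prod, prod_erase_eq_prod_swap]
  congr 1
  refine Finset.prod_congr rfl fun b _ => ?_
  simp [Lagrange.basisDivisor, div_eq_mul_inv, mul_comm]

/-- The summand of the value of a block whose top colours differ from that of the lower boundary
at the positions `I`. -/
def blockWeight {k L : ℕ} (I : Fin k → Fin L) (x : Fin k → ℂ) (y : Fin L → ℂ) : ℂ :=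
  (∏ a, (∏ i ∈ Finset.Iio (I a), (x a - y i)) * ∏ i ∈ Finset.Ioi (I a), (x a - y i + 1)) *
    amplitude 1 x

lemma prod_Iio_succ {n : ℕ} {R : Type*} [CommMonoid R] (g : Fin (n + 1) → R) (b : Fin n) :
    ∏ i ∈ Finset.Iio b.succ, g i = g 0 * ∏ i ∈ Finset.Iio b, g i.succ := by
  have : Finset.Iio b.succ = Finset.cons 0 ((Finset.Iio b).map (Fin.succEmb n)) (by simp) := by
    ext i
    induction i using Fin.cases <;> simp
  rw [this, Finset.prod_cons, Finset.prod_map]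
  rfl

lemma blockWeight_succ {k L : ℕ} (I : Fin k → Fin L) (x : Fin k → ℂ) (y : Fin (L + 1) → ℂ) :
    blockWeight (fun a => (I a).succ) x y =
      (∏ a, (x a - y 0)) * blockWeight I x fun l => y l.succ := by
  simp only [blockWeight, prod_Iio_succ, Fin.prod_Ioi_succ, mul_assoc, Finset.prod_mul_distrib]

lemma amplitude_cons {k : ℕ} (γ z : ℂ) (x : Fin k → ℂ) :
    amplitude γ (Fin.cons z x : Fin (k + 1) → ℂ) =
      (∏ b, (z - x b - γ) / (z - x b)) * amplitude γ x := by
  simp only [amplitude, Fin.prod_univ_succ, Fin.prod_Ioi_succ, Fin.prod_Ioi_zero, Fin.cons_zero,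
    Fin.cons_succ]

lemma blockWeight_cons {k L : ℕ} (I : Fin k → Fin L) (z : ℂ) (x : Fin k → ℂ)
    (y : Fin (L + 1) → ℂ) :
    blockWeight (Fin.cons 0 fun a => (I a).succ) (Fin.cons z x) y =
      (∏ l : Fin L, (z - y l.succ + 1)) * (∏ a, (x a - y 0) * ((z - x a - 1) / (z - x a))) *
        blockWeight I x fun l => y l.succ := by
  simp only [blockWeight, Fin.prod_univ_succ, Fin.cons_zero, Fin.cons_succ, prod_Iio_succ,
    Fin.prod_Ioi_succ, Fin.prod_Ioi_zero, amplitude_cons, Finset.prod_mul_distrib]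
  have : Finset.Iio (0 : Fin (L + 1)) = ∅ := by ext; simp
  rw [this, Finset.prod_empty]
  ring

/-- The first column is either diagonal or determined by interpolation at $y_0=x_a$. The chosen `a`
is the image of `0` under the permutation, and the inductive hypothesis supplies the permutations of
the rest. -/
theorem blockFn_eq_sum (v : C) {L k : ℕ} {f : (Fin k → C) → (Fin k → ℂ) → ℂ} (hf : Exchange f)
    (hfv : ∀ c x a, c a = v → f c x = 0) {I : Fin k → Fin L} (hI : StrictMono I) (i : Fin L → C)
    (hiI : ∀ a, i (I a) ≠ v) (hi : ∀ l, l ∉ Set.range I → i l = v) {x : Fin k → ℂ}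
    (hx : Function.Injective x) (y : Fin L → ℂ) :
    blockFn v x y i (fun c => f c x) =
      ∑ σ : Equiv.Perm (Fin k), blockWeight I (x ∘ σ) y * f (i ∘ I) (x ∘ σ) := by
  induction L generalizing k with
  | zero =>
    have : IsEmpty (Fin k) := ⟨fun a => (I a).elim0⟩
    simp only [blockFn, Fintype.sum_unique, blockWeight, amplitude, Finset.univ_eq_empty,
      Finset.prod_empty, one_mul]
    congr 1
    exact Subsingleton.elim _ _
  | succ L ih =>
    by_cases h0 : 0 ∈ Set.range I
    · obtain ⟨a0, ha0⟩ := h0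
      cases k with
      | zero => exact a0.elim0
      | succ k =>
        have hI0 : I 0 = 0 := le_antisymm (ha0 ▸ hI.monotone (Fin.zero_le a0)) (Fin.zero_le _)
        have hIs : ∀ a : Fin k, ∃ b, Fin.succ b = I a.succ := fun a =>
          Fin.exists_succ_eq.2 (hI0 ▸ (hI (Fin.succ_pos a)).ne')
        choose I' hI' using hIs
        have hII : I = Fin.cons 0 fun a => (I' a).succ := by
          ext a; induction a using Fin.cases <;> simp [hI0, hI']
        have hI'm : StrictMono I' := fun a b hab => by
          rw [← Fin.succ_lt_succ_iff, hI', hI']; exact hI (Fin.succ_lt_succ_iff.2 hab)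
        have hw : i ∘ I = Fin.cons (i 0) ((fun l => i l.succ) ∘ I') := by
          ext a; induction a using Fin.cases <;> simp [hI0, ← hI']
        have hv : i 0 ≠ v := hI0 ▸ hiI 0
        obtain ⟨y0, y, rfl⟩ : ∃ y0 y', y = Fin.cons y0 y' :=
          ⟨y 0, Fin.tail y, (Fin.cons_self_tail y).symm⟩
        -- polynomial dependence on the first vertical parameter
        obtain ⟨P, hP, hP'⟩ : ∃ P ∈ Polynomial.degreeLT ℂ (k + 1), ∀ y0,
            blockFn v x (Fin.cons y0 y) i (fun c => f c x) = P.eval y0 := by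
          choose Q hQ hQ' using column_degreeLT hv x
          refine ⟨∑ c, f c x • ∑ e, blockFn v x y (fun l => i l.succ) (Pi.single e 1) • Q c e,
            Submodule.sum_mem _ fun c _ => Submodule.smul_mem _ _ <|
              Submodule.sum_mem _ fun e _ => Submodule.smul_mem _ _ (hQ c e), fun y0 => ?_⟩
          -- The remaining columns act linearly and do not involve `y0`; expanding in the basis of
          -- words isolates the dependence on it.
          have : transfer v (i 0) y0 x (fun c => f c x) = fun e' => ∑ e,
              transfer v (i 0) y0 x (fun c => f c x) e * (Pi.single e 1 : (Fin (k + 1) → C) → ℂ) e' := by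
            ext e'
            simp [Pi.single_apply]
          rw [blockFn, Fin.cons_zero, this, blockFn_sum]
          simp only [Polynomial.eval_finsetSum, Polynomial.eval_smul, smul_eq_mul, ← hQ', transfer,
            Finset.mul_sum, Finset.sum_mul, Fin.cons_succ]
          rw [Finset.sum_comm]
          exact Finset.sum_congr rfl fun c _ => Finset.sum_congr rfl fun e _ => by ring
        have hval : ∀ a, P.eval (x a) =
            (∏ b : Fin k, (x (Equiv.swap 0 a b.succ) - x a + 1)) * (∏ l, (x a - y l + 1)) *
            ∑ σ : Equiv.Perm (Fin k), blockWeight I' (fun b => x (Equiv.swap 0 a (σ b).succ)) y *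
              f (i ∘ I) (Fin.cons (x a) fun b => x (Equiv.swap 0 a (σ b).succ)) := by
          intro a
          -- This permutation puts $x_a$ on the lowest line and the others in the order of
          -- `eval_eq_sum_swap`.
          set τ : Equiv.Perm (Fin (k + 1)) := Equiv.swap 0 a * finRotate (k + 1)
          have hτ : ∀ b : Fin k, τ b.castSucc = Equiv.swap 0 a b.succ := fun b => by simp [τ]
          have hτl : τ (Fin.last k) = a := by simp [τ]
          have h1 := hf.blockFn_zero_eq_last v (x ∘ τ) y i
          rw [hf.blockFn_perm] at h1
          simp only [Function.comp_apply, hτl, hτ] at h1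
          rw [← hP', h1, ih (hf.cons (i 0) (x a)) (fun c z b hb => hfv _ _ b.succ (by simpa using hb))
            hI'm (x := fun b : Fin k => x (Equiv.swap 0 a b.succ)) (fun l => i l.succ) (fun b => hI' b ▸ hiI _) (fun l hl => hi _ fun ⟨b, hb⟩ => hl ?_)
            (hx.comp ((Equiv.injective _).comp (Fin.succ_injective k)))]
          · rw [hw]; rfl
          · induction b using Fin.cases with
            | zero => rw [hI0] at hb; exact absurd hb.symm (Fin.succ_ne_zero l)
            | succ b => exact ⟨b, Fin.succ_injective _ (by rw [hI', hb])⟩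
        rw [hP', eval_eq_sum_swap hP hx, ← Equiv.sum_comp Equiv.Perm.decomposeFin.symm,
          Fintype.sum_prod_type]
        refine Finset.sum_congr rfl fun a _ => ?_
        have hσ : ∀ σ : Equiv.Perm (Fin k), x ∘ Equiv.Perm.decomposeFin.symm (a, σ) =
            Fin.cons (x a) fun b => x (Equiv.swap 0 a (σ b).succ) := fun σ => by
          ext b; induction b using Fin.cases <;> simp
        simp only [hσ, hval, Finset.mul_sum, Finset.sum_mul]
        refine Finset.sum_congr rfl fun σ _ => ?_
        rw [hII, blockWeight_cons, ← hII]
        simp only [Fin.cons_zero, Fin.cons_succ]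
        -- The freezing factor and the Lagrange basis polynomial combine into the amplitude and the
        -- factors $x_b-y_0$: two signs cancel for each `b`.
        have hprod : ∏ b : Fin k, (x (Equiv.swap 0 a (σ b).succ) - y0) *
            ((x a - x (Equiv.swap 0 a (σ b).succ) - 1) / (x a - x (Equiv.swap 0 a (σ b).succ))) =
            (∏ b : Fin k, (x (Equiv.swap 0 a b.succ) - x a + 1)) * ∏ b : Fin k,
              ((y0 - x (Equiv.swap 0 a b.succ)) / (x a - x (Equiv.swap 0 a b.succ))) := by
          rw [Equiv.prod_comp σ fun b : Fin k => (x (Equiv.swap 0 a b.succ) - y0) *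
            ((x a - x (Equiv.swap 0 a b.succ) - 1) / (x a - x (Equiv.swap 0 a b.succ))),
            ← Finset.prod_mul_distrib]
          exact Finset.prod_congr rfl fun b _ => by ring
        rw [hprod]
        ring
    · have hIs : ∀ a, ∃ b, Fin.succ b = I a := fun a => Fin.exists_succ_eq.2 fun h => h0 ⟨a, h⟩
      choose I' hI' using hIs
      obtain rfl : (fun a => (I' a).succ) = I := funext hI'
      rw [blockFn, hi 0 h0, funext (transfer_self v (y 0) x (fun c => f c x)
        (fun c a h => hfv c x a h)), blockFn_smul, ih hf hfv (I := I')
        (fun a b hab => Fin.succ_lt_succ_iff.1 (hI hab)) _ hiI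
        (fun l hl => hi _ fun ⟨b, hb⟩ => hl ⟨b, Fin.succ_injective _ hb⟩) hx, Finset.mul_sum]
      refine Finset.sum_congr rfl fun σ _ => ?_
      rw [blockWeight_succ, ← mul_assoc]
      congr 2
      exact (Equiv.prod_comp σ fun a => x a - y 0).symm

end Blocks

/-! ### Recursion over the nodes -/

section Levels

variable {M : ℕ}

@[simp] lemma levels_castSucc {k : Fin (M + 1) → ℕ} (u : ∀ p : Fin M, Fin (k p.castSucc) → ℂ)
    (m : Fin (k (Fin.last M)) → ℂ) (p : Fin M) : levels u m p.castSucc = u p := by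
  simp [levels]

@[simp] lemma levels_last {k : Fin (M + 1) → ℕ} (u : ∀ p : Fin M, Fin (k p.castSucc) → ℂ)
    (m : Fin (k (Fin.last M)) → ℂ) : levels u m (Fin.last M) = m := by
  simp [levels]

lemma levels_init {k : Fin (M + 2) → ℕ} (u : ∀ p : Fin (M + 1), Fin (k p.castSucc) → ℂ)
    (p : Fin (M + 1)) :
    levels (k := fun p : Fin (M + 1) => k p.castSucc) (fun p => u p.castSucc) (u (Fin.last M)) p =
      u p := by
  induction p using Fin.lastCases with
  | last => exact levels_last (k := fun p : Fin (M + 1) => k p.castSucc) _ _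
  | cast p => exact levels_castSucc (k := fun p : Fin (M + 1) => k p.castSucc) _ _ p

/-- The symmetrized product of blocks at arbitrary positions `J`. -/
def symBlocks (γ : ℂ) (k : Fin (M + 1) → ℕ) (J : ∀ p : Fin M, Fin (k p.castSucc) → Fin (k p.succ))
    (u : ∀ p : Fin M, Fin (k p.castSucc) → ℂ) (m : Fin (k (Fin.last M)) → ℂ) : ℂ :=
  sym (fun u' => ∏ p : Fin M, omega γ (J p) (levels u' m p.castSucc) (levels u' m p.succ)) u

lemma symBlocks_zero (γ : ℂ) (k : Fin 1 → ℕ) (J u m) : symBlocks γ k J u m = 1 := by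
  simp [symBlocks, sym]

/-- For a fixed permutation at the last node, its permuted variables are the masses of a quiver with
one node fewer. Arbitrary `J` are needed because the truncated quiver has its index sets in a
different flavour set. -/
lemma symBlocks_succ (γ : ℂ) (k : Fin (M + 2) → ℕ)
    (J : ∀ p : Fin (M + 1), Fin (k p.castSucc) → Fin (k p.succ))
    (u : ∀ p : Fin (M + 1), Fin (k p.castSucc) → ℂ) (m : Fin (k (Fin.last (M + 1))) → ℂ) :
    symBlocks γ k J u m = ∑ σ : Equiv.Perm (Fin (k (Fin.last M).castSucc)),
      omega γ (J (Fin.last M)) (fun a => u (Fin.last M) (σ a)) m *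
        symBlocks γ (fun p : Fin (M + 1) => k p.castSucc) (fun p => J p.castSucc)
          (fun p => u p.castSucc) (fun a => u (Fin.last M) (σ a)) := by
  rw [symBlocks, sym,
    ← (Fin.snocEquiv fun p : Fin (M + 1) => Equiv.Perm (Fin (k p.castSucc))).sum_comp,
    Fintype.sum_prod_type]
  refine Finset.sum_congr rfl fun σ _ => ?_
  rw [symBlocks, sym, Finset.mul_sum]
  refine Finset.sum_congr rfl fun τ _ => ?_
  set U : ∀ p : Fin (M + 1), Fin (k p.castSucc) → ℂ := fun p a =>
    u p ((Fin.snocEquiv fun p : Fin (M + 1) => Equiv.Perm (Fin (k p.castSucc))) (σ, τ) p a) with hU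
  have hUl : U (Fin.last M) = fun a => u (Fin.last M) (σ a) := by
    simp [hU, Fin.snocEquiv]
  have hUc : (fun p : Fin M => U p.castSucc) = fun p a => u p.castSucc (τ p a) := by
    simp [hU, Fin.snocEquiv]
  rw [Fin.prod_univ_castSucc, mul_comm, levels_castSucc, hUl, ← hUc, ← hUl]
  congr 1
  · exact congrArg _ (levels_last U m)
  · refine Finset.prod_congr rfl fun p _ => ?_
    rw [levels_castSucc, levels_init U p.castSucc, levels_init U p.succ]
    exact congrArg _ (levels_castSucc U m p.succ)

/-! ### The nested Bethe wavefunction -/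

/-- The full product contains the factor at $i=I_a$, which is absent from $\omega$ and becomes the
pole of the one-particle function. -/
lemma omega_eq_oneParticle {γ : ℂ} {n L : ℕ} (I : Fin n → Fin L) (u : Fin n → ℂ) (v : Fin L → ℂ)
    (h : ∀ a b, u a - v b + γ / 2 ≠ 0) :
    omega γ I u v =
      (∏ a, ∏ b, (u a - v b + γ / 2)) * (amplitude γ u * ∏ a, oneParticle γ v (u a) (I a)) := by
  rw [omega, ← amplitude, mul_left_comm, mul_comm (amplitude γ u), ← Finset.prod_mul_distrib,
    mul_comm _ (amplitude γ u), mul_comm _ (amplitude γ u)]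
  congr 1
  refine Finset.prod_congr rfl fun a _ => ?_
  have hsplit : ∏ b, (u a - v b + γ / 2) = (∏ b ∈ Finset.Iio (I a), (u a - v b + γ / 2)) *
      (u a - v (I a) + γ / 2) * ∏ b ∈ Finset.Ioi (I a), (u a - v b + γ / 2) := by
    rw [Finset.prod_Iio_mul_eq_prod_Iic, ← Finset.prod_union]
    · congr 1
      ext b
      simp [le_or_gt]
    · rw [Finset.disjoint_left]
      intro b
      simp
  rw [hsplit, oneParticle, Finset.prod_div_distrib]
  have h1 : ∏ b ∈ Finset.Iio (I a), (u a - v b + γ / 2) ≠ 0 := Finset.prod_ne_zero_iff.2 fun b _ => h a b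
  have h2 := h a (I a)
  have key : ∀ {P Q R r : ℂ}, Q ≠ 0 → r ≠ 0 → P * R = Q * r * R * (1 / r * (P / Q)) := by
    intro P Q R r hQ hr
    field_simp
  exact key h1 h2

lemma symBlocks_eq_nestedBethe (γ : ℂ) (k : Fin (M + 1) → ℕ)
    (J : ∀ p : Fin M, Fin (k p.castSucc) → Fin (k p.succ))
    (u : ∀ p : Fin M, Fin (k p.castSucc) → ℂ) (m : Fin (k (Fin.last M)) → ℂ)
    (h : ∀ p a b, u p a - levels u m p.succ b + γ / 2 ≠ 0) :
    symBlocks γ k J u m =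
      (∏ p, ∏ a, ∏ b, (u p a - levels u m p.succ b + γ / 2)) * nestedBethe γ k J u m := by
  induction M with
  | zero => simp [symBlocks_zero, nestedBethe]
  | succ M ih =>
    rw [symBlocks_succ, nestedBethe, Finset.mul_sum]
    refine Finset.sum_congr rfl fun σ _ => ?_
    -- The recursion changes the levels only by permuting the variables of one of them, which the
    -- products over all pairs do not see.
    have hperm : ∀ q : Fin (M + 1), ∃ π : Equiv.Perm (Fin (k q.castSucc)), ∀ b,
        levels (k := fun p : Fin (M + 1) => k p.castSucc) (fun p => u p.castSucc)
          (fun a => u (Fin.last M) (σ a)) q b = levels u m q.castSucc (π b) := by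
      intro q
      rw [levels_castSucc]
      induction q using Fin.lastCases with
      | last =>
        exact ⟨σ, fun b => congrFun (levels_last (k := fun p : Fin (M + 1) => k p.castSucc) _ _) b⟩
      | cast q =>
        exact ⟨1, fun b =>
          congrFun (levels_castSucc (k := fun p : Fin (M + 1) => k p.castSucc) _ _ q) b⟩
    have hm : ∀ a b, u (Fin.last M) a - m b + γ / 2 ≠ 0 := fun a b => by
      have := h (Fin.last M) a b
      rwa [show levels u m (Fin.last M).succ = m from levels_last u m] at this
    rw [omega_eq_oneParticle _ _ _ fun a b => hm (σ a) b, ih]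
    · rw [Fin.prod_univ_castSucc, show levels u m (Fin.last M).succ = m from levels_last u m,
        Equiv.prod_comp σ fun a => ∏ b, (u (Fin.last M) a - m b + γ / 2)]
      have : ∀ p : Fin M, ∀ a, ∏ b, (u p.castSucc a - levels (k := fun p : Fin (M + 1) => k p.castSucc)
          (fun p => u p.castSucc) (fun a => u (Fin.last M) (σ a)) p.succ b + γ / 2) =
          ∏ b, (u p.castSucc a - levels u m p.castSucc.succ b + γ / 2) := by
        intro p a
        obtain ⟨π, hπ⟩ := hperm p.succ
        simp only [hπ]
        exact Equiv.prod_comp π fun b => u p.castSucc a - levels u m p.succ.castSucc b + γ / 2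
      simp only [this]
      have key : ∀ A B C D E : ℂ, A * (B * C) * (D * E) = D * A * (B * C * E) := by intros; ring
      exact key _ _ _ _ _
    · intro p a b
      obtain ⟨π, hπ⟩ := hperm p.succ
      rw [hπ]
      exact h p.castSucc a (π b)

end Levels

/-! ### Nested blocks -/

section NestedLattice

variable {C : Type*} [DecidableEq C] [Fintype C]

/-- Colour conservation: the colours leaving a vertex of nonzero weight upwards and to the right are
those entering it. -/
lemma column_ne_zero {S : Set C} {y : ℂ} {k : ℕ} {x : Fin k → ℂ} {c e : Fin k → C} {t b : C}
    (hc : ∀ a, c a ∈ S) (hb : b ∈ S) (h : column y x c e t b ≠ 0) : t ∈ S ∧ ∀ a, e a ∈ S := by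
  induction k generalizing t with
  | zero =>
    rw [column_zero, Matrix.one_apply] at h
    obtain rfl : t = b := by by_contra h'; simp [h'] at h
    exact ⟨hb, fun a => a.elim0⟩
  | succ k ih =>
    rw [column_succ, Matrix.mul_apply] at h
    obtain ⟨s, -, hs⟩ := Finset.exists_ne_zero_of_sum_ne_zero h
    obtain ⟨hsS, he⟩ := ih (fun a => hc a.succ) (right_ne_zero_of_mul hs)
    have hM := left_ne_zero_of_mul hs
    have : (c 0 = e 0 ∧ s = t) ∨ (c 0 = t ∧ s = e 0) := by
      by_contra h'
      rw [not_or] at h'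
      simp [vertexMatrix, h'.1, h'.2] at hM
    have h0 := hc 0
    rcases this with ⟨h1, h2⟩ | ⟨h1, h2⟩
    · refine ⟨h2 ▸ hsS, fun a => ?_⟩
      induction a using Fin.cases with
      | zero => exact h1 ▸ h0
      | succ a => exact he a
    · refine ⟨h1 ▸ h0, fun a => ?_⟩
      induction a using Fin.cases with
      | zero => exact h2 ▸ hsS
      | succ a => exact he a

lemma blockFn_ne_zero {S : Set C} {v : C} (hv : v ∈ S) {k : ℕ} {x : Fin k → ℂ} {L : ℕ}
    {y : Fin L → ℂ} {i : Fin L → C} {f : (Fin k → C) → ℂ} (hf : ∀ c, f c ≠ 0 → ∀ a, c a ∈ S)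
    (h : blockFn v x y i f ≠ 0) (l : Fin L) : i l ∈ S := by
  induction L generalizing f with
  | zero => exact l.elim0
  | succ L ih =>
    rw [blockFn] at h
    have key : ∀ e, transfer v (i 0) (y 0) x f e ≠ 0 → i 0 ∈ S ∧ ∀ a, e a ∈ S := by
      intro e he
      obtain ⟨c, -, hc⟩ := Finset.exists_ne_zero_of_sum_ne_zero he
      exact column_ne_zero (hf c (left_ne_zero_of_mul hc)) hv (right_ne_zero_of_mul hc)
    induction l using Fin.cases with
    | zero =>
      by_contra h0
      have : transfer v (i 0) (y 0) x f = fun _ => 0 * 0 := by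
        ext e
        by_contra he
        exact h0 (key e (by simpa using he)).1
      rw [this, blockFn_smul, zero_mul] at h
      exact h rfl
    | succ l => exact ih (fun e he => (key e he).2) h l

/-- The lattice built of one block for each node, the lower and right colours of the block of the
node `p` being `κ p.succ`, the left colours of the first block `κ 0`, and the upper colours of the
last one `w`. -/
def nestedLattice : ∀ {M : ℕ} (_ : Fin (M + 1) → C) (k : Fin (M + 1) → ℕ)
    (_ : ∀ p : Fin M, Fin (k p.castSucc) → ℂ) (_ : Fin (k (Fin.last M)) → ℂ)
    (_ : Fin (k (Fin.last M)) → C), ℂ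
  | 0, κ, _, _, _, w => if ∀ a, w a = κ 0 then 1 else 0
  | M + 1, κ, k, x, y, w => blockFn (κ (Fin.last (M + 1))) (x (Fin.last M)) y w fun c =>
      nestedLattice (fun p : Fin (M + 1) => κ p.castSucc) (fun p => k p.castSucc)
        (fun p => x p.castSucc) (x (Fin.last M)) c

/-- Without nodes the condition on the word is symmetric; with nodes the last block alone gives the
relation. -/
lemma exchange_nestedLattice {M : ℕ} (κ : Fin (M + 1) → C) (k : Fin (M + 1) → ℕ)
    (x : ∀ p : Fin M, Fin (k p.castSucc) → ℂ) :
    Exchange fun w y => nestedLattice κ k x y w := by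
  cases M with
  | zero =>
    intro i j hij c y
    have : (∀ a, (c ∘ Equiv.swap i j) a = κ 0) ↔ ∀ a, c a = κ 0 :=
      ⟨fun h a => by simpa using h (Equiv.swap i j a), fun h a => h _⟩
    simp only [nestedLattice, this]
    ring
  | succ M => exact exchange_blockFn _ _ _ _

lemma nestedLattice_ne_zero {M : ℕ} {κ : Fin (M + 1) → C} {k : Fin (M + 1) → ℕ}
    {x : ∀ p : Fin M, Fin (k p.castSucc) → ℂ} {y : Fin (k (Fin.last M)) → ℂ}
    {w : Fin (k (Fin.last M)) → C} (h : nestedLattice κ k x y w ≠ 0) (l : Fin (k (Fin.last M))) :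
    w l ∈ Set.range κ := by
  induction M with
  | zero =>
    rw [nestedLattice] at h
    by_contra h'
    have hne : ¬ ∀ a, w a = κ 0 := fun h'' => h' ⟨0, (h'' l).symm⟩
    exact h (if_neg hne)
  | succ M ih =>
    rw [nestedLattice] at h
    refine blockFn_ne_zero (Set.mem_range_self _) (fun c hc a => ?_) h l
    obtain ⟨q, hq⟩ := ih hc a
    exact ⟨_, hq⟩

lemma omega_one_eq_blockWeight {k L : ℕ} (I : Fin k → Fin L) {u x : Fin k → ℂ} {m y : Fin L → ℂ}
    {s : ℂ} (hu : ∀ a, u a = x a + (s + 1 / 2)) (hm : ∀ l, m l = y l + s) :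
    omega 1 I u m = blockWeight I x y := by
  have h1 : ∀ a i, u a - m i - 1 / 2 = x a - y i := fun a i => by rw [hu, hm]; ring
  have h2 : ∀ a i, u a - m i + 1 / 2 = x a - y i + 1 := fun a i => by rw [hu, hm]; ring
  have h3 : ∀ a b, u a - u b = x a - x b := fun a b => by rw [hu, hu]; ring
  simp only [omega, blockWeight, amplitude, h1, h2, h3]

/-- The shifts `s` absorb the $\pm\frac12$ of each block, one half per level. Colours stay in a
fixed type, labelled by an injective `κ`, so that removing a node only restricts `κ`. -/
theorem nestedLattice_eq_symBlocks {M : ℕ} {κ : Fin (M + 1) → C} (hκ : Function.Injective κ)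
    {k : Fin (M + 1) → ℕ} {J : ∀ p : Fin M, Fin (k p.castSucc) → Fin (k p.succ)}
    (hJ : ∀ p, StrictMono (J p)) (w : ∀ p : Fin (M + 1), Fin (k p) → C) (hw0 : ∀ a, w 0 a = κ 0)
    (hwJ : ∀ p a, w p.succ (J p a) = w p.castSucc a)
    (hwκ : ∀ p l, l ∉ Set.range (J p) → w p.succ l = κ p.succ)
    (hwne : ∀ (p : Fin M) a, w p.castSucc a ≠ κ p.succ)
    {x u : ∀ p : Fin M, Fin (k p.castSucc) → ℂ} (hx : ∀ p, Function.Injective (x p))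
    {y m : Fin (k (Fin.last M)) → ℂ} (s : Fin (M + 1) → ℂ) (hs : ∀ p : Fin M, s p.castSucc = s p.succ + 1 / 2)
    (hu : ∀ p a, u p a = x p a + s p.castSucc) (hm : ∀ l, m l = y l + s (Fin.last M)) :
    nestedLattice κ k x y (w (Fin.last M)) = symBlocks 1 k J u m := by
  induction M with
  | zero =>
    rw [symBlocks_zero, nestedLattice]
    exact if_pos hw0
  | succ M ih =>
    rw [nestedLattice, symBlocks_succ]
    rw [blockFn_eq_sum (κ (Fin.last (M + 1))) (exchange_nestedLattice (fun p : Fin (M + 1) => κ p.castSucc)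
      (fun p => k p.castSucc) (fun p => x p.castSucc)) ?_ (hJ (Fin.last M)) (w (Fin.last (M + 1)))
      (fun a => ?_) (hwκ (Fin.last M)) (hx (Fin.last M)) y]
    · refine Finset.sum_congr rfl fun σ _ => ?_
      have hJw : w (Fin.last (M + 1)) ∘ J (Fin.last M) = w (Fin.last M).castSucc :=
        funext fun a => hwJ (Fin.last M) a
      rw [hJw]
      congr 1
      · refine (omega_one_eq_blockWeight (s := s (Fin.last (M + 1))) _ (fun a => ?_) hm).symm
        rw [hu, hs]; rfl
      · exact ih (κ := fun p => κ p.castSucc) (hκ.comp (Fin.castSucc_injective _))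
          (k := fun p => k p.castSucc) (fun p => hJ p.castSucc) (fun p => w p.castSucc) hw0
          (fun p a => hwJ p.castSucc a) (fun p l => hwκ p.castSucc l) (fun p a => hwne p.castSucc a)
          (fun p => hx p.castSucc) (fun p => s p.castSucc) (fun p => hs p.castSucc)
          (fun p a => hu p.castSucc a) (fun l => hu (Fin.last M) (σ l))
    · intro c z a ha
      -- By colour conservation the earlier blocks never emit the new boundary colour.
      by_contra h
      obtain ⟨q, hq⟩ := nestedLattice_ne_zero h a
      exact (Fin.castSucc_lt_last q).ne (hκ (hq.trans ha))
    · exact (hwJ (Fin.last M) a).trans_ne (hwne (Fin.last M) a)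

end NestedLattice

/-! ### Sums over colourings -/

section Colourings

variable {C : Type*} [DecidableEq C] [Fintype C]

lemma column_eq_sum (y : ℂ) {k : ℕ} (x : Fin k → ℂ) (c e : Fin k → C) (t b : C) :
    column y x c e t b = ∑ g : Fin (k + 1) → C, if g 0 = t ∧ g (Fin.last k) = b then
      ∏ a, vertexMatrix (x a - y) (c a) (e a) (g a.castSucc) (g a.succ) else 0 := by
  induction k generalizing t with
  | zero =>
    rw [column_zero, sum_word_cons, Matrix.one_apply]
    have : (Fin.last 0) = 0 := rfl
    simp [this, ite_and]
  | succ k ih =>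
    rw [column_succ, Matrix.mul_apply, sum_word_cons]
    simp only [ih, Fin.cons_zero, ← Fin.succ_last, Fin.cons_succ, Fin.prod_univ_succ,
      Fin.castSucc_zero, ← Fin.succ_castSucc, Finset.mul_sum, ite_and, mul_ite, mul_zero]
    rw [Finset.sum_comm, Finset.sum_comm (s := Finset.univ (α := C))]
    simp

omit [DecidableEq C] in
lemma sum_words_cons {ι : Type*} [Fintype ι] [DecidableEq ι] {n : ℕ}
    (F : (ι → Fin (n + 1) → C) → ℂ) :
    ∑ h, F h = ∑ e : ι → C, ∑ h : ι → Fin n → C, F fun a => Fin.cons (e a) (h a) := by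
  let E : (ι → C) × (ι → Fin n → C) ≃ (ι → Fin (n + 1) → C) :=
    { toFun := fun q a => Fin.cons (q.1 a) (q.2 a)
      invFun := fun h => (fun a => h a 0, fun a => Fin.tail (h a))
      left_inv := fun q => by simp
      right_inv := fun h => by ext a : 1; simp }
  rw [← E.sum_comp, Fintype.sum_prod_type]
  rfl

lemma blockFn_eq_sum_colourings (v : C) {k : ℕ} (x : Fin k → ℂ) {L : ℕ} (y : Fin L → ℂ)
    (i : Fin L → C) (f : (Fin k → C) → ℂ) :
    blockFn v x y i f = ∑ h : Fin k → Fin (L + 1) → C, ∑ g : Fin (k + 1) → Fin L → C,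
      f (fun a => h a 0) *
        if (∀ a, h a (Fin.last L) = v) ∧ (∀ b, g 0 b = i b) ∧ ∀ b, g (Fin.last k) b = v then
          ∏ a, ∏ b, vertexMatrix (x a - y b) (h a b.castSucc) (h a b.succ) (g a.castSucc b) (g a.succ b)
        else 0 := by
  induction L generalizing f with
  | zero =>
    rw [blockFn, Finset.sum_eq_single fun _ _ => v]
    · simp
    · intro h _ hne
      refine Finset.sum_eq_zero fun g _ => ?_
      rw [if_neg, mul_zero]
      rintro ⟨h1, -⟩
      refine hne (funext fun a => funext fun j => ?_)
      rw [← h1 a]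
      congr 1
      exact Subsingleton.elim (α := Fin 1) _ _
    · simp
  | succ L ih =>
    rw [blockFn, ih]
    symm
    rw [sum_words_cons, Finset.sum_comm]
    refine Finset.sum_congr rfl fun h _ => ?_
    simp only [sum_words_cons]
    refine (Finset.sum_congr rfl fun c _ => Finset.sum_comm).trans (Finset.sum_comm.trans ?_)
    refine Finset.sum_congr rfl fun g _ => ?_
    rw [transfer, Finset.sum_mul]
    refine Finset.sum_congr rfl fun c _ => ?_
    rw [column_eq_sum, Finset.mul_sum, Finset.sum_mul]
    refine Finset.sum_congr rfl fun g0 _ => ?_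
    symm
    simp only [← Fin.succ_last, Fin.cons_succ, Fin.cons_zero, Fin.forall_fin_succ,
      Fin.prod_univ_succ (n := L), Fin.castSucc_zero, ← Fin.succ_castSucc, Finset.prod_mul_distrib]
    have key : ∀ (A P Q p q : Prop) [Decidable A] [Decidable P] [Decidable Q] [Decidable p]
        [Decidable q] (z₁ z₂ : ℂ), (if p ∧ q then z₁ else 0) * (if A ∧ P ∧ Q then z₂ else 0) =
          if A ∧ (p ∧ P) ∧ q ∧ Q then z₁ * z₂ else 0 := by
      intro A P Q p q _ _ _ _ _ z₁ z₂
      by_cases hp : p ∧ q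
      · simp only [hp.1, hp.2, and_self, true_and, if_true, mul_ite, mul_zero]
      · have hn : ¬ (A ∧ (p ∧ P) ∧ q ∧ Q) := fun h => hp ⟨h.2.1.1, h.2.2.1⟩
        rw [if_neg hp, if_neg hn, zero_mul]
    rw [mul_assoc, key]

lemma blockFn_eq_sum_single (v : C) {k : ℕ} (x : Fin k → ℂ) {L : ℕ} (y : Fin L → ℂ)
    (i : Fin L → C) (f : (Fin k → C) → ℂ) :
    blockFn v x y i f = ∑ c, f c * blockFn v x y i (Pi.single c 1) := by
  rw [← blockFn_sum]
  congr 1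
  ext c
  simp [Pi.single_apply]

/-- Cutting along the bonds that join consecutive blocks makes the lattice a sum of products of
independent blocks. -/
lemma nestedLattice_eq_sum {M : ℕ} (κ : Fin (M + 1) → C) (k : Fin (M + 1) → ℕ)
    (x : ∀ p : Fin M, Fin (k p.castSucc) → ℂ) (y : Fin (k (Fin.last M)) → ℂ)
    (w : Fin (k (Fin.last M)) → C) :
    nestedLattice κ k x y w = ∑ link : ∀ p : Fin (M + 1), Fin (k p) → C,
      if (∀ a, link 0 a = κ 0) ∧ link (Fin.last M) = w then
        ∏ p : Fin M, blockFn (κ p.succ) (x p) (levels x y p.succ) (link p.succ)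
          (Pi.single (link p.castSucc) 1) else 0 := by
  induction M with
  | zero =>
    rw [nestedLattice, ← (Fin.snocEquiv fun p : Fin 1 => Fin (k p) → C).sum_comp,
      Fintype.sum_prod_type, Finset.sum_eq_single w]
    · have h1 : ∀ l : ∀ p : Fin 0, Fin (k p.castSucc) → C,
          (Fin.snocEquiv fun p : Fin 1 => Fin (k p) → C) (w, l) (Fin.last 0) = w :=
        fun l => Fin.snoc_last (α := fun p : Fin 1 => Fin (k p) → C) w l
      rw [Fintype.sum_unique, Finset.univ_eq_empty, Finset.prod_empty]
      refine if_congr ⟨fun h => ⟨fun a => ?_, h1 _⟩, fun h a => ?_⟩ rfl rfl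
      · exact (congrFun (h1 default) a).trans (h a)
      · exact (congrFun (h1 default) a).symm.trans (h.1 a)
    · intro b _ hb
      refine Finset.sum_eq_zero fun l _ => if_neg fun h => hb ?_
      rw [← h.2]
      exact (Fin.snoc_last (α := fun p : Fin 1 => Fin (k p) → C) b l).symm
    · simp
  | succ M ih =>
    rw [nestedLattice, blockFn_eq_sum_single,
      ← (Fin.snocEquiv fun p : Fin (M + 2) => Fin (k p) → C).sum_comp,
      Fintype.sum_prod_type, Finset.sum_eq_single w]
    · simp only [ih, Finset.sum_mul]
      rw [Finset.sum_comm]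
      refine Finset.sum_congr rfl fun link _ => ?_
      set l := (Fin.snocEquiv fun p : Fin (M + 2) => Fin (k p) → C) (w, link) with hl
      have hlast : l (Fin.last (M + 1)) = w := by simp [hl, Fin.snocEquiv]
      have hcast : ∀ p : Fin (M + 1), l p.castSucc = link p := by simp [hl, Fin.snocEquiv]
      rw [Finset.sum_eq_single (link (Fin.last M))]
      · rw [ite_mul, zero_mul]
        have h0 : ∀ a, l 0 a = link 0 a := congrFun (hcast 0)
        refine if_congr ⟨fun h => ⟨fun a => (h0 a).trans (h.1 a), hlast⟩,
          fun h => ⟨fun a => (h0 a).symm.trans (h.1 a), rfl⟩⟩ ?_ rfl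
        rw [Fin.prod_univ_castSucc, hcast (Fin.last M)]
        congr 1
        · refine Finset.prod_congr rfl fun p _ => ?_
          have h1 : l p.castSucc.succ = link p.succ := hcast p.succ
          have h2 : levels x y p.castSucc.succ = x p.succ := levels_castSucc x y p.succ
          rw [hcast, h1, h2, levels_init]
          rfl
        · rw [show levels x y (Fin.last M).succ = y from levels_last x y,
            show l (Fin.last M).succ = w from hlast]
          rfl
      · intro c _ hc
        rw [if_neg (fun h => hc h.2.symm), zero_mul]
      · simp
    · intro b _ hb
      simp [Fin.snocEquiv, hb]
    · simp

end Colourings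

section Configurations

variable {M : ℕ} {k : Fin (M + 1) → ℕ}

lemma vertexWeight_eq_vertexMatrix {n : ℕ} (x y : ℂ) (l b r t : Fin n) :
    vertexWeight x y l b r t = vertexMatrix (x - y) l r t b := by
  rw [vertexWeight, vertexMatrix]
  by_cases h1 : l = r
  · subst h1
    by_cases h2 : b = t
    · subst h2
      by_cases h3 : l = b
      · simp [h3]
      · simp [h3, Ne.symm h3]
    · have h3 : ¬ (l = t ∧ b = l) := fun h => h2 (h.2.trans h.1)
      have h4 : ¬ (l = b ∧ l = l ∧ t = l) := fun h => h3 ⟨h.2.2.symm, h.1.symm⟩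
      have h5 : ¬ (l = l ∧ b = t) := fun h => h2 h.2
      rw [if_neg h4, if_neg h5, if_neg h3, if_neg h5, add_zero]
  · simp [h1, Ne.symm h1]

theorem latticePartitionFn_eq_nestedLattice (i : Fin (k (Fin.last M)) → Fin (M + 1))
    (x : ∀ p : Fin M, Fin (k p.castSucc) → ℂ) (y : Fin (k (Fin.last M)) → ℂ) :
    latticePartitionFn i x y = nestedLattice id k x y i := by
  let E : (∀ p : Fin (M + 1), Fin (k p) → Fin (M + 1)) ×
      (∀ p : Fin M, Fin (k p.castSucc) → Fin (k p.succ + 1) → Fin (M + 1)) ×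
      (∀ p : Fin M, Fin (k p.castSucc + 1) → Fin (k p.succ) → Fin (M + 1)) ≃ Colouring k :=
    { toFun := fun q => ⟨q.1, q.2.1, q.2.2⟩
      invFun := fun s => (s.link, s.hor, s.ver)
      left_inv := fun _ => rfl
      right_inv := fun _ => rfl }
  rw [latticePartitionFn, Finset.sum_filter, ← E.sum_comp, Fintype.sum_prod_type,
    nestedLattice_eq_sum]
  refine Finset.sum_congr rfl fun link _ => ?_
  rw [Fintype.sum_prod_type]
  simp only [blockFn_eq_sum_colourings]
  have hprod : ∀ {β : Fin M → Type} [∀ p, Fintype (β p)] (F : ∀ p, β p → ℂ),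
      ∏ p, ∑ b, F p b = ∑ b : ∀ p, β p, ∏ p, F p (b p) := fun F => by
    rw [Finset.prod_univ_sum, Fintype.piFinset_univ]
  simp only [hprod, id_eq]
  by_cases hl : (∀ a, link 0 a = 0) ∧ link (Fin.last M) = i
  · rw [if_pos hl]
    refine Finset.sum_congr rfl fun hor _ => Finset.sum_congr rfl fun ver _ => ?_
    by_cases hb : ∀ p, (fun a => hor p a 0) = link p.castSucc ∧
        (∀ a, hor p a (Fin.last _) = p.succ) ∧ (∀ b, ver p 0 b = link p.succ b) ∧
        ∀ b, ver p (Fin.last _) b = p.succ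
    · rw [if_pos ⟨hl.1, congrFun hl.2, fun p => congrFun (hb p).1, fun p => (hb p).2.1,
        fun p => (hb p).2.2.1, fun p => (hb p).2.2.2⟩]
      refine Finset.prod_congr rfl fun p _ => ?_
      obtain ⟨h1, h2, h3, h4⟩ := hb p
      rw [if_pos ⟨h2, h3, h4⟩, h1, Pi.single_eq_same, one_mul, levels_castSucc]
      simp only [vertexWeight_eq_vertexMatrix]
      rfl
    · rw [if_neg fun h => hb fun p => ⟨funext (h.left p), h.right p, h.top p, h.bottom p⟩]
      push Not at hb
      obtain ⟨p, hp⟩ := hb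
      -- A violated boundary condition on block `p` already makes the factor of that block vanish.
      refine (Finset.prod_eq_zero (Finset.mem_univ p) ?_).symm
      by_cases h1 : (fun a => hor p a 0) = link p.castSucc
      · rw [if_neg, mul_zero]
        rintro ⟨h2, h3, h4⟩
        obtain ⟨b, hb⟩ := hp h1 h2 h3
        exact hb (h4 b)
      · rw [Pi.single_eq_of_ne h1, zero_mul]
  · rw [if_neg hl]
    refine Finset.sum_eq_zero fun hor _ => Finset.sum_eq_zero fun ver _ => if_neg fun h => hl ?_
    exact ⟨h.first, funext h.last⟩

end Configurations

/-! ### Positions and colours of nested sets -/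

namespace NestedSets

variable {M : ℕ} {k : Fin (M + 1) → ℕ} (I : NestedSets k)

lemma pos_strictMono (p : Fin (M + 1)) : StrictMono (I.pos p) :=
  ((I.set p).orderEmbOfFin (I.card_eq p)).strictMono

lemma pos_mem (p : Fin (M + 1)) (a : Fin (k p)) : I.pos p a ∈ I.set p :=
  (I.set p).orderEmbOfFin_mem (I.card_eq p) a

lemma exists_pos_eq {p : Fin (M + 1)} {l : Fin (k (Fin.last M))} (hl : l ∈ I.set p) :
    ∃ a, I.pos p a = l := by
  have h := (I.set p).range_orderEmbOfFin (I.card_eq p)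
  exact (Set.ext_iff.1 h l).2 hl

lemma pos_tilde (p : Fin M) (a : Fin (k p.castSucc)) :
    I.pos p.succ (I.tilde p a) = I.pos p.castSucc a := by
  have h := ((I.set p.succ).orderIsoOfFin (I.card_eq p.succ)).apply_symm_apply
    ⟨I.pos p.castSucc a, I.subset_succ p (I.pos_mem p.castSucc a)⟩
  exact congrArg Subtype.val h

lemma tilde_strictMono (p : Fin M) : StrictMono (I.tilde p) := fun a b hab => by
  rw [← (I.pos_strictMono p.succ).lt_iff_lt, I.pos_tilde, I.pos_tilde]
  exact I.pos_strictMono _ hab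

lemma set_mono : Monotone I.set := Fin.monotone_iff_le_succ.2 I.subset_succ

lemma pos_last (l : Fin (k (Fin.last M))) : I.pos (Fin.last M) l = l := by
  have hu : I.set (Fin.last M) = Finset.univ :=
    Finset.eq_univ_of_card _ (by rw [I.card_eq, Fintype.card_fin])
  have h := Finset.orderEmbOfFin_unique (I.card_eq (Fin.last M)) (f := id)
    (fun l => by rw [hu]; exact Finset.mem_univ _) strictMono_id
  exact (congrFun h l).symm

lemma card_castSucc_lt (p : Fin (M + 1)) :
    (Finset.univ.filter fun q : Fin M => q.castSucc < p).card = p := by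
  have h := Fin.card_filter_val_lt (n := M) (m := p)
  rw [min_eq_right (Nat.lt_succ_iff.1 p.2)] at h
  exact h

/-- The colour counts the sets missing `l`; if these are the first `p` levels, the count is `p`. -/
lemma colour_eq {p : Fin (M + 1)} {l : Fin (k (Fin.last M))}
    (h : ∀ q : Fin M, l ∉ I.set q.castSucc ↔ q.castSucc < p) : I.colour l = p := by
  ext
  simp only [colour, h]
  exact card_castSucc_lt p

lemma colour_pos_le (p : Fin (M + 1)) (a : Fin (k p)) : I.colour (I.pos p a) ≤ p := by
  rw [Fin.le_def, ← card_castSucc_lt p]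
  change (Finset.univ.filter fun q : Fin M => I.pos p a ∉ I.set q.castSucc).card ≤ _
  refine Finset.card_le_card fun q hq => ?_
  rw [Finset.mem_filter] at hq ⊢
  exact ⟨hq.1, not_le.1 fun h => hq.2 (I.set_mono h (I.pos_mem p a))⟩

theorem symOmega_one_eq (u : ∀ p : Fin M, Fin (k p.castSucc) → ℂ) (m : Fin (k (Fin.last M)) → ℂ)
    (hu : ∀ p, Function.Injective (u p)) :
    I.symOmega 1 u m =
      latticePartitionFn I.colour (fun p a => u p a - ((M : ℂ) - ((p : ℕ) : ℂ)) / 2) m := by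
  have hw : I.colour = fun l => I.colour (I.pos (Fin.last M) l) := funext fun l => by rw [I.pos_last]
  rw [latticePartitionFn_eq_nestedLattice, hw]
  refine (nestedLattice_eq_symBlocks Function.injective_id I.tilde_strictMono
    (fun p l => I.colour (I.pos p l)) (fun a => ?_) (fun p a => ?_) (fun p l hl => ?_)
    (fun p a => ?_) (fun p a b hab => ?_) (fun p : Fin (M + 1) => ((M : ℂ) - ((p : ℕ) : ℂ)) / 2)
    (fun p => ?_) (fun p a => ?_) (fun l => ?_)).symm
  · exact le_antisymm (I.colour_pos_le 0 a) (Fin.zero_le _)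
  · rw [I.pos_tilde]
  · refine I.colour_eq fun q => ?_
    rw [id_eq, Fin.castSucc_lt_succ_iff]
    refine ⟨fun h => not_lt.1 fun hq => h ?_, fun h h' => hl ?_⟩
    · exact I.set_mono (Fin.succ_le_castSucc_iff.2 hq) (I.pos_mem p.succ l)
    · obtain ⟨a, ha⟩ := I.exists_pos_eq (I.set_mono (Fin.castSucc_le_castSucc_iff.2 h) h')
      exact ⟨a, (I.pos_strictMono p.succ).injective (by rw [I.pos_tilde, ha])⟩
  · exact ((I.colour_pos_le p.castSucc a).trans_lt (Fin.castSucc_lt_succ)).ne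
  · exact hu p (by simpa using hab)
  · simp only [Fin.val_castSucc, Fin.val_succ]
    push_cast
    ring
  · simp only [Fin.val_castSucc]
    ring
  · simp

theorem symOmega_eq_nestedBethe (γ : ℂ) (u : ∀ p : Fin M, Fin (k p.castSucc) → ℂ)
    (m : Fin (k (Fin.last M)) → ℂ) (h : ∀ p a b, u p a - levels u m p.succ b + γ / 2 ≠ 0) :
    I.symOmega γ u m = (∏ p, ∏ a, ∏ b, (u p a - levels u m p.succ b + γ / 2)) *
      nestedBethe γ k I.tilde u m :=
  symBlocks_eq_nestedBethe γ k I.tilde u m h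

end NestedSets

/-! ### The invariant part of the orbifolded character -/

/-- With $x=q\zeta^n$, $\frac1{1-x}=\frac{1+x+\dots+x^{L-1}}{1-q^L}$, and orthogonality of roots of
unity keeps only the power $j=e$. -/
lemma sum_zpow_div_one_sub {L : ℕ} {ζ q : ℂ} (hζ : IsPrimitiveRoot ζ L) (hq : q ≠ 0)
    (hqL : q ^ L ≠ 1) {e : ℕ} (he : e < L) :
    ∑ n : Fin L, (q * ζ ^ (n : ℕ)) ^ (-(e : ℤ)) / (1 - q * ζ ^ (n : ℕ)) = L / (1 - q ^ L) := by
  have hL : L ≠ 0 := by omega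
  have hζ0 : ζ ≠ 0 := hζ.ne_zero hL
  have hx0 : ∀ n : ℕ, q * ζ ^ n ≠ 0 := fun n => mul_ne_zero hq (pow_ne_zero _ hζ0)
  have hxL : ∀ n : ℕ, (q * ζ ^ n) ^ L = q ^ L := fun n => by
    rw [mul_pow, ← pow_mul, mul_comm n, pow_mul, hζ.pow_eq_one, one_pow, mul_one]
  have h1 : ∀ n : ℕ, (q * ζ ^ n) ^ (-(e : ℤ)) / (1 - q * ζ ^ n) =
      (∑ j ∈ Finset.range L, (q * ζ ^ n) ^ ((j : ℤ) - e)) / (1 - q ^ L) := by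
    intro n
    have hne : 1 - q * ζ ^ n ≠ 0 := fun h => hqL (by
      rw [← hxL n, ← sub_eq_zero.1 h, one_pow])
    rw [div_eq_div_iff hne (sub_ne_zero.2 hqL.symm), ← hxL n, ← mul_neg_geom_sum]
    have : ∀ j : ℕ, (q * ζ ^ n) ^ ((j : ℤ) - e) = (q * ζ ^ n) ^ (-(e : ℤ)) * (q * ζ ^ n) ^ j := by
      intro j
      rw [sub_eq_neg_add, zpow_add₀ (hx0 n), zpow_natCast]
    simp only [this, ← Finset.mul_sum]
    ring
  simp only [h1]
  rw [← Finset.sum_div, Finset.sum_comm, Finset.sum_eq_single e]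
  · simp
  · intro j hj hje
    have hj := Finset.mem_range.1 hj
    have h2 : ∀ n : ℕ, (q * ζ ^ n) ^ ((j : ℤ) - e) = q ^ ((j : ℤ) - e) * (ζ ^ ((j : ℤ) - e)) ^ n := by
      intro n
      rw [mul_zpow, ← zpow_natCast, ← zpow_natCast, ← zpow_mul, ← zpow_mul, mul_comm (n : ℤ)]
    simp only [h2]
    rw [← Finset.mul_sum, Fin.sum_univ_eq_sum_range fun n => (ζ ^ ((j : ℤ) - e)) ^ n]
    have hne : ζ ^ ((j : ℤ) - e) ≠ 1 := by
      rw [Ne, hζ.zpow_eq_one_iff_dvd]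
      intro h
      have := Int.eq_zero_of_abs_lt_dvd h (by rw [abs_lt]; omega)
      omega
    have hpow : (ζ ^ ((j : ℤ) - e)) ^ L = 1 := by
      rw [← zpow_natCast, ← zpow_mul, mul_comm, zpow_mul, zpow_natCast, hζ.pow_eq_one, one_zpow]
    rw [geom_sum_eq hne, hpow, sub_self, zero_div, mul_zero]
  · intro h
    exact absurd (Finset.mem_range.2 he) h

lemma average_exp {L : ℕ} (A : ℂ) {h : ℂ} (hh : Complex.exp h ≠ 1) {d : ℤ} (h1 : -(L : ℤ) < d)
    (h2 : d ≤ L) :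
    1 / (L : ℂ) * ∑ n : Fin L,
      Complex.exp (A + d * ((h + 2 * Real.pi * Complex.I * ((n : ℕ) : ℂ)) / L)) /
        (1 - Complex.exp ((h + 2 * Real.pi * Complex.I * ((n : ℕ) : ℂ)) / L)) =
      Complex.exp A / (1 - Complex.exp h) - if 0 < d then Complex.exp A else 0 := by
  have hL : L ≠ 0 := by omega
  have hLC : (L : ℂ) ≠ 0 := Nat.cast_ne_zero.2 hL
  have hζ := Complex.isPrimitiveRoot_exp L hL
  have hq : ∀ n : ℕ, Complex.exp ((h + 2 * Real.pi * Complex.I * (n : ℂ)) / L) =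
      Complex.exp (h / L) * Complex.exp (2 * Real.pi * Complex.I / L) ^ n := fun n => by
    rw [← Complex.exp_nat_mul, ← Complex.exp_add]
    congr 1
    ring
  have hqL : Complex.exp (h / L) ^ L = Complex.exp h := by
    rw [← Complex.exp_nat_mul, mul_div_cancel₀ _ hLC]
  have hxL : ∀ n : ℕ, (Complex.exp (h / L) * Complex.exp (2 * Real.pi * Complex.I / L) ^ n) ^ L =
      Complex.exp h := fun n => by
    rw [mul_pow, hqL, ← pow_mul, mul_comm n, pow_mul, hζ.pow_eq_one, one_pow, mul_one]
  have hne : 1 - Complex.exp h ≠ 0 := sub_ne_zero.2 hh.symm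
  have key := fun e he => sum_zpow_div_one_sub (e := e) hζ (Complex.exp_ne_zero (h / L)) (by rwa [hqL]) he
  have hexp : ∀ n : ℕ, Complex.exp (A + d * ((h + 2 * Real.pi * Complex.I * (n : ℂ)) / L)) =
      Complex.exp A *
        (Complex.exp (h / L) * Complex.exp (2 * Real.pi * Complex.I / L) ^ n) ^ d := fun n => by
    rw [Complex.exp_add, Complex.exp_int_mul, hq]
  have hx0 : ∀ n : ℕ, Complex.exp (h / L) * Complex.exp (2 * Real.pi * Complex.I / L) ^ n ≠ 0 :=
    fun n => mul_ne_zero (Complex.exp_ne_zero _) (pow_ne_zero _ (Complex.exp_ne_zero _))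
  simp only [hexp, hq]
  clear hexp hq hζ
  generalize Complex.exp (2 * Real.pi * Complex.I / L) = ζ at *
  split_ifs with hd
  -- The extra $L$ contributes $e^h$, and $e^h/(1-e^h)=1/(1-e^h)-1$.
  · obtain ⟨e, rfl⟩ : ∃ e : ℕ, d = L + -(e : ℤ) := ⟨(L - d).toNat, by omega⟩
    simp only [zpow_add₀ (hx0 _), zpow_natCast, hxL, mul_div_assoc, ← Finset.mul_sum]
    rw [key e (by omega), hqL]
    field_simp
    ring
  · obtain ⟨e, rfl⟩ : ∃ e : ℕ, d = -(e : ℤ) := ⟨(-d).toNat, by omega⟩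
    simp only [mul_div_assoc, ← Finset.mul_sum]
    rw [key e (by omega), hqL]
    field_simp
    ring

/-! ### The surplus exponentials at each node -/

section Existence

variable {M : ℕ} {k : Fin (M + 1) → ℕ}

/-- The linear form `u⁽ᵖ⁾_a`. -/
def coordForm (p : Fin (M + 1)) (a : Fin (k p)) : Module.Dual ℂ (Params k) :=
  LinearMap.proj a ∘ₗ LinearMap.proj p ∘ₗ LinearMap.fst ℂ _ _

variable (k) in
/-- The linear form `γ`. -/
def gammaForm : Module.Dual ℂ (Params k) :=
  LinearMap.fst ℂ _ _ ∘ₗ LinearMap.snd ℂ _ _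

@[simp] lemma coordForm_apply (p : Fin (M + 1)) (a : Fin (k p)) (z : Params k) :
    coordForm p a z = z.1 p a := rfl

@[simp] lemma gammaForm_apply (z : Params k) : gammaForm k z = z.2.1 := rfl

namespace NestedSets

variable (I : NestedSets k)

/-- The forms `w_I` of the defect character. -/
def denForms (_ : NestedSets k) : Module.Dual ℂ (Params k) →₀ ℕ :=
  ∑ p : Fin M, ∑ a : Fin (k p.castSucc), ∑ b : Fin (k p.castSucc),
    ((if b < a then Finsupp.single (coordForm p.castSucc a - coordForm p.castSucc b) 1 else 0) +
      if a < b then Finsupp.single (coordForm p.castSucc a - coordForm p.castSucc b + gammaForm k) 1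
      else 0)

/-- The forms `v_J` of the defect character. -/
def numForms : Module.Dual ℂ (Params k) →₀ ℕ :=
  ∑ p : Fin M, ∑ a : Fin (k p.castSucc), ∑ b : Fin (k p.succ),
    ((if b < I.tilde p a then Finsupp.single
        (coordForm p.castSucc a - coordForm p.succ b - (1 / 2 : ℂ) • gammaForm k) 1 else 0) +
      if I.tilde p a < b then Finsupp.single
        (-coordForm p.castSucc a + coordForm p.succ b - (1 / 2 : ℂ) • gammaForm k) 1 else 0)

end NestedSets

variable (k) in
/-- Multiplicities as integers. -/
def natToExpSum : (Module.Dual ℂ (Params k) →₀ ℕ) →+ ExpSum k :=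
  Finsupp.mapRange.addMonoidHom (Nat.castAddMonoidHom ℤ)

/-- The defect character. -/
def NestedSets.defectChar (I : NestedSets k) : ExpSum k :=
  natToExpSum k I.denForms - natToExpSum k I.numForms

/-- The value of a sum of exponentials. -/
def ExpSum.eval (z : Params k) : ExpSum k →+ ℂ :=
  Finsupp.liftAddHom fun w =>
    (AddMonoidHom.mulRight (Complex.exp (w z))).comp (Int.castAddHom ℂ)

lemma ExpSum.eval_apply (z : Params k) (c : ExpSum k) :
    ExpSum.eval z c = c.sum fun w n => (n : ℂ) * Complex.exp (w z) := rfl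

lemma ExpSum.eval_single (z : Params k) (w : Module.Dual ℂ (Params k)) :
    ExpSum.eval z (natToExpSum k (Finsupp.single w 1)) = Complex.exp (w z) := by
  simp [ExpSum.eval, natToExpSum]

lemma average_sum_sum {L m n : ℕ} (F : Fin L → Fin m → Fin n → ℂ) :
    1 / (L : ℂ) * ∑ j, ∑ a, ∑ b, F j a b = ∑ a, ∑ b, 1 / (L : ℂ) * ∑ j, F j a b := by
  rw [Finset.sum_comm, Finset.mul_sum]
  refine Finset.sum_congr rfl fun a _ => ?_
  rw [Finset.sum_comm, Finset.mul_sum]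

namespace NestedSets

variable (I : NestedSets k) (p : Fin M) (z : Params k)

/-- The image of the parameters under `ħ → ħ + 2πi n` and the orbifold shift. -/
def orbit (n : Fin (k (Fin.last M))) : Params k :=
  I.orbifoldShift (z.1, z.2.1, z.2.2 + 2 * Real.pi * Complex.I * ((n : ℕ) : ℂ))

variable {z}

lemma average_charV (hz : Complex.exp z.2.2 ≠ 1) :
    1 / (k (Fin.last M) : ℂ) * ∑ n, charV p (I.orbit z n) = charV p z +
      ∑ a : Fin (k p.castSucc), ∑ b : Fin (k p.castSucc),
        if b < a then Complex.exp (z.1 p.castSucc a - z.1 p.castSucc b) else 0 := by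
  simp only [charV]
  rw [Finset.sum_neg_distrib, mul_neg, average_sum_sum, neg_add_eq_sub, ← neg_sub]
  congr 1
  simp only [← Finset.sum_sub_distrib]
  refine Finset.sum_congr rfl fun a _ => Finset.sum_congr rfl fun b _ => ?_
  by_cases hab : a = b
  · simp [hab]
  simp only [if_neg hab]
  have h := average_exp (L := k (Fin.last M)) (z.1 p.castSucc a - z.1 p.castSucc b) hz
    (d := (I.pos p.castSucc a : ℤ) - I.pos p.castSucc b) (by omega) (by omega)
  have hd : 0 < (I.pos p.castSucc a : ℤ) - I.pos p.castSucc b ↔ b < a := by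
    rw [← (I.pos_strictMono p.castSucc).lt_iff_lt, Fin.lt_def]; omega
  simp only [hd] at h
  rw [← h]
  congr 1
  refine Finset.sum_congr rfl fun n _ => ?_
  simp only [orbit, orbifoldShift]
  push_cast
  congr 2
  ring

/-- The $\hbar$ in the exponent shifts $d$ to $I_a-I_b+1$, which may equal $L$. The unorbifolded
term already has the form of the case $d>0$, so the surplus occurs for $d\le0$, that is, for $a<b$.
-/
lemma average_charPhi (hz : Complex.exp z.2.2 ≠ 1) :
    1 / (k (Fin.last M) : ℂ) * ∑ n, charPhi p (I.orbit z n) = charPhi p z +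
      ∑ a : Fin (k p.castSucc), ∑ b : Fin (k p.castSucc),
        if a < b then Complex.exp (z.1 p.castSucc a - z.1 p.castSucc b + z.2.1) else 0 := by
  simp only [charPhi]
  rw [average_sum_sum, ← Finset.sum_add_distrib]
  refine Finset.sum_congr rfl fun a _ => ?_
  rw [← Finset.sum_add_distrib]
  refine Finset.sum_congr rfl fun b _ => ?_
  have h := average_exp (L := k (Fin.last M)) (z.1 p.castSucc a - z.1 p.castSucc b + z.2.1) hz
    (d := (I.pos p.castSucc a : ℤ) - I.pos p.castSucc b + 1) (by omega) (by omega)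
  have hd : 0 < (I.pos p.castSucc a : ℤ) - I.pos p.castSucc b + 1 ↔ ¬ a < b := by
    rw [← (I.pos_strictMono p.castSucc).lt_iff_lt, Fin.lt_def]; omega
  simp only [hd] at h
  have hne : 1 - Complex.exp z.2.2 ≠ 0 := sub_ne_zero.2 hz.symm
  trans Complex.exp (z.1 p.castSucc a - z.1 p.castSucc b + z.2.1) / (1 - Complex.exp z.2.2) -
      if ¬ a < b then Complex.exp (z.1 p.castSucc a - z.1 p.castSucc b + z.2.1) else 0
  · rw [← h]
    congr 1
    refine Finset.sum_congr rfl fun n _ => ?_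
    simp only [orbit, orbifoldShift]
    push_cast
    congr 2
    ring
  · rw [Complex.exp_add _ z.2.2]
    by_cases hab : a < b
    · simp only [hab, not_true_eq_false, if_false, if_true]
      field_simp
      ring
    · simp only [hab, not_false_eq_true, if_false, if_true]
      field_simp
      ring

/-- Here $d=I^{(p)}_a-I^{(p+1)}_b$, and $I^{(p)}_a$ is the element of $I^{(p+1)}$ at position
$\widetilde I^{(p)}_a$, so $d>0$ compares positions. -/
lemma average_charA (hz : Complex.exp z.2.2 ≠ 1) :
    1 / (k (Fin.last M) : ℂ) * ∑ n, charA p (I.orbit z n) = charA p z -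
      ∑ a : Fin (k p.castSucc), ∑ b : Fin (k p.succ), if b < I.tilde p a then
        Complex.exp (z.1 p.castSucc a - z.1 p.succ b - z.2.1 / 2) else 0 := by
  simp only [charA]
  rw [average_sum_sum]
  simp only [← Finset.sum_sub_distrib]
  refine Finset.sum_congr rfl fun a _ => Finset.sum_congr rfl fun b _ => ?_
  have h := average_exp (L := k (Fin.last M)) (z.1 p.castSucc a - z.1 p.succ b - z.2.1 / 2) hz
    (d := (I.pos p.castSucc a : ℤ) - I.pos p.succ b) (by omega) (by omega)
  have hd : 0 < (I.pos p.castSucc a : ℤ) - I.pos p.succ b ↔ b < I.tilde p a := by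
    rw [← (I.pos_strictMono p.succ).lt_iff_lt, I.pos_tilde, Fin.lt_def]; omega
  simp only [hd] at h
  rw [← h]
  congr 1
  refine Finset.sum_congr rfl fun n _ => ?_
  simp only [orbit, orbifoldShift]
  push_cast
  congr 2
  ring

lemma average_charB (hz : Complex.exp z.2.2 ≠ 1) :
    1 / (k (Fin.last M) : ℂ) * ∑ n, charB p (I.orbit z n) = charB p z -
      ∑ a : Fin (k p.castSucc), ∑ b : Fin (k p.succ), if I.tilde p a < b then
        Complex.exp (-z.1 p.castSucc a + z.1 p.succ b - z.2.1 / 2) else 0 := by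
  simp only [charB]
  rw [average_sum_sum]
  simp only [← Finset.sum_sub_distrib]
  refine Finset.sum_congr rfl fun a _ => Finset.sum_congr rfl fun b _ => ?_
  have h := average_exp (L := k (Fin.last M)) (-z.1 p.castSucc a + z.1 p.succ b - z.2.1 / 2) hz
    (d := (I.pos p.succ b : ℤ) - I.pos p.castSucc a) (by omega) (by omega)
  have hd : 0 < (I.pos p.succ b : ℤ) - I.pos p.castSucc a ↔ I.tilde p a < b := by
    rw [← (I.pos_strictMono p.succ).lt_iff_lt, I.pos_tilde, Fin.lt_def]; omega
  simp only [hd] at h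
  rw [← h]
  congr 1
  refine Finset.sum_congr rfl fun n _ => ?_
  simp only [orbit, orbifoldShift]
  push_cast
  congr 2
  ring

theorem isDefectChar_defectChar : I.IsDefectChar I.defectChar := by
  intro z hz
  have h1 : I.invariantChar z = ∑ p : Fin M,
      (1 / (k (Fin.last M) : ℂ) * ∑ n, charV p (I.orbit z n) +
        1 / (k (Fin.last M) : ℂ) * ∑ n, charPhi p (I.orbit z n) +
        1 / (k (Fin.last M) : ℂ) * ∑ n, charA p (I.orbit z n) +
        1 / (k (Fin.last M) : ℂ) * ∑ n, charB p (I.orbit z n)) := by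
    simp only [invariantChar, totalChar]
    rw [Finset.sum_comm, Finset.mul_sum]
    simp only [Finset.sum_add_distrib, mul_add]
    rfl
  have hite : ∀ (P : Prop) [Decidable P] (w : Module.Dual ℂ (Params k)),
      ExpSum.eval z (natToExpSum k (if P then Finsupp.single w 1 else 0)) =
        if P then Complex.exp (w z) else 0 := by
    intro P _ w
    split_ifs
    · exact ExpSum.eval_single z w
    · simp
  rw [h1, ← ExpSum.eval_apply, defectChar, denForms, numForms, map_sub]
  simp only [map_sum, map_add, hite, I.average_charV _ hz, I.average_charPhi _ hz,
    I.average_charA _ hz, I.average_charB _ hz, LinearMap.sub_apply, LinearMap.add_apply,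
    LinearMap.neg_apply, LinearMap.smul_apply, coordForm_apply, gammaForm_apply, smul_eq_mul,
    totalChar, Finset.sum_add_distrib, Finset.sum_sub_distrib]
  have hhalf : (1 / 2 : ℂ) * z.2.1 = z.2.1 / 2 := by ring
  rw [hhalf]
  ring

end NestedSets

end Existence

/-! ### Uniqueness of the defect character -/

section Uniqueness

variable {M : ℕ} {k : Fin (M + 1) → ℕ}

/-- The exponential of a linear form as a character of the additive group of parameters. -/
def expHom (w : Module.Dual ℂ (Params k)) : Multiplicative (Params k) →* ℂ where
  toFun z := Complex.exp (w z.toAdd)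
  map_one' := by simp
  map_mul' x y := by simp [Complex.exp_add]

/-- If two forms differ at a point, rescaling it makes the difference $1$, and $e\ne1$. -/
lemma expHom_injective : Function.Injective (expHom (k := k)) := by
  intro w w' h
  refine LinearMap.ext fun z => ?_
  by_contra hne
  have hz : w z - w' z ≠ 0 := sub_ne_zero.2 hne
  have h1 : Complex.exp (w ((w z - w' z)⁻¹ • z)) = Complex.exp (w' ((w z - w' z)⁻¹ • z)) :=
    DFunLike.congr_fun h (Multiplicative.ofAdd ((w z - w' z)⁻¹ • z))
  have h2 : Complex.exp (w ((w z - w' z)⁻¹ • z) - w' ((w z - w' z)⁻¹ • z)) = 1 := by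
    rw [Complex.exp_sub, h1, div_self (Complex.exp_ne_zero _)]
  rw [map_smul, map_smul, ← smul_sub, smul_eq_mul, inv_mul_cancel₀ hz] at h2
  have h3 := congrArg norm h2
  rw [Complex.norm_exp, Complex.one_re, norm_one, Real.exp_eq_one_iff] at h3
  exact one_ne_zero h3

lemma ExpSum.eq_zero_of_eval_eq_zero {c : ExpSum k} (h : ∀ z, ExpSum.eval z c = 0) : c = 0 := by
  have hli := (linearIndependent_monoidHom (Multiplicative (Params k)) ℂ).comp _
    (expHom_injective (k := k))
  have h0 := linearIndependent_iff.1 hli (c.mapRange (fun n : ℤ => (n : ℂ)) Int.cast_zero) (by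
    ext z
    have hz := h z.toAdd
    rw [ExpSum.eval_apply, Finsupp.sum] at hz
    rw [Finsupp.linearCombination_apply, Finsupp.sum_mapRange_index (by simp), Finsupp.sum,
      Finset.sum_apply]
    exact hz)
  ext w
  have hw := DFunLike.congr_fun h0 w
  rw [Finsupp.mapRange_apply] at hw
  exact Int.cast_eq_zero.1 hw

/-- Moving $\hbar$ by a real $t>0$ from a point with $e^\hbar=1$ gives $|e^{\hbar+t}|\neq1$;
continuity at $t=0$ concludes. -/
lemma ExpSum.eval_eq_zero_of_generic {c : ExpSum k}
    (h : ∀ z : Params k, Complex.exp z.2.2 ≠ 1 → ExpSum.eval z c = 0) (z : Params k) :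
    ExpSum.eval z c = 0 := by
  by_cases hz : Complex.exp z.2.2 = 1
  · have hcont : Continuous fun t : ℝ => ExpSum.eval (z + (t : ℂ) • (0, 0, 1)) c := by
      simp only [ExpSum.eval_apply, Finsupp.sum, map_add, map_smul, smul_eq_mul]
      fun_prop
    have hsub : Set.Ioi (0 : ℝ) ⊆ {t | ExpSum.eval (z + (t : ℂ) • (0, 0, 1)) c = 0} := by
      intro t ht
      refine h _ fun h' => ?_
      have h1 : Complex.exp (z.2.2 + t) = 1 := by simpa using h'
      rw [Complex.exp_add, hz, one_mul] at h1
      have h2 := congrArg norm h1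
      rw [Complex.norm_exp, Complex.ofReal_re, norm_one, Real.exp_eq_one_iff] at h2
      exact (Set.mem_Ioi.1 ht).ne' h2
    have hcl := closure_minimal hsub (isClosed_eq hcont continuous_const)
    rw [closure_Ioi] at hcl
    have h0 : ExpSum.eval (z + ((0 : ℝ) : ℂ) • ((0, 0, 1) : Params k)) c = 0 :=
      hcl (Set.mem_Ici.2 le_rfl)
    rwa [Complex.ofReal_zero, zero_smul, add_zero] at h0
  · exact h z hz

theorem NestedSets.IsDefectChar.unique {I : NestedSets k} {c c' : ExpSum k} (hc : I.IsDefectChar c)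
    (hc' : I.IsDefectChar c') : c = c' := by
  refine sub_eq_zero.1 (ExpSum.eq_zero_of_eval_eq_zero (ExpSum.eval_eq_zero_of_generic fun z hz => ?_))
  rw [map_sub, ExpSum.eval_apply, ExpSum.eval_apply, sub_eq_zero]
  exact add_left_cancel ((hc z hz).symm.trans (hc' z hz))

end Uniqueness

/-! ### The normalized defect -/

section Defect

variable {M : ℕ} {k : Fin (M + 1) → ℕ} (I : NestedSets k)

/-- The coefficient of $\gamma$ is $-\frac12$ in the numerator forms and $0$ or $1$ in the others,
so nothing cancels between them. -/
lemma NestedSets.disjoint_support :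
    Disjoint (natToExpSum k I.denForms).support (-natToExpSum k I.numForms).support := by
  have hden : I.denForms ∈ Finsupp.supported ℕ ℕ {w | w (0, 1, 0) ≠ -(1 / 2)} := by
    refine Submodule.sum_mem _ fun p _ => Submodule.sum_mem _ fun a _ => Submodule.sum_mem _
      fun b _ => Submodule.add_mem _ ?_ ?_
    · split_ifs
      · exact Finsupp.single_mem_supported _ _ (by simp)
      · exact zero_mem _
    · split_ifs
      · exact Finsupp.single_mem_supported _ _ (by norm_num)
      · exact zero_mem _
  have hnum : I.numForms ∈ Finsupp.supported ℕ ℕ {w | w (0, 1, 0) = -(1 / 2)} := by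
    refine Submodule.sum_mem _ fun p _ => Submodule.sum_mem _ fun a _ => Submodule.sum_mem _
      fun b _ => Submodule.add_mem _ ?_ ?_
    · split_ifs
      · exact Finsupp.single_mem_supported _ _ (by simp)
      · exact zero_mem _
    · split_ifs
      · exact Finsupp.single_mem_supported _ _ (by simp)
      · exact zero_mem _
  rw [Finsupp.support_neg, Finset.disjoint_left]
  intro w hw hw'
  exact hden (Finsupp.support_mapRange (hf := map_zero (Nat.castAddMonoidHom ℤ)) hw)
    (hnum (Finsupp.support_mapRange (hf := map_zero (Nat.castAddMonoidHom ℤ)) hw'))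

/-- Natural multiplicities matter: integer powers are not additive in the exponent at a zero of the
form. -/
lemma prod_pow_sum_ite {ι κ : Type*} [Fintype ι] {α β : ι → Type*} [∀ p, Fintype (α p)]
    [∀ p, Fintype (β p)] (P Q : ∀ p, α p → β p → Prop) [∀ p a b, Decidable (P p a b)]
    [∀ p a b, Decidable (Q p a b)] (v w : ∀ p, α p → β p → κ) (f : κ → ℂ) :
    (∑ p, ∑ a, ∑ b, ((if P p a b then Finsupp.single (v p a b) 1 else 0) +
      if Q p a b then Finsupp.single (w p a b) 1 else 0 : κ →₀ ℕ)).prod (fun x n => f x ^ n) =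
    ∏ p, ((∏ a, ∏ b, if P p a b then f (v p a b) else 1) *
      ∏ a, ∏ b, if Q p a b then f (w p a b) else 1) := by
  have h0 : ∀ x, f x ^ 0 = 1 := fun x => pow_zero _
  have h1 : ∀ x m n, f x ^ (m + n) = f x ^ m * f x ^ n := fun x m n => pow_add _ _ _
  have hite : ∀ (R : Prop) [Decidable R] (x : κ),
      (if R then Finsupp.single x 1 else 0 : κ →₀ ℕ).prod (fun x n => f x ^ n) =
        if R then f x else 1 := by
    intro R _ x
    split_ifs
    · exact (Finsupp.prod_single_index (h := fun x n => f x ^ n) (h0 x)).trans (pow_one _)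
    · exact Finsupp.prod_zero_index
  simp only [← Finsupp.prod_finsetSum_index (h := fun x n => f x ^ n) h0 h1,
    Finsupp.prod_add_index' (h := fun x n => f x ^ n) h0 h1, hite,
    Finset.prod_mul_distrib]

lemma NestedSets.partitionFn_defectChar (z : Params k) :
    partitionFn I.defectChar z = ∏ p : Fin M,
      (((∏ a : Fin (k p.castSucc), ∏ b : Fin (k p.castSucc),
          if b < a then (z.1 p.castSucc a - z.1 p.castSucc b)⁻¹ else 1) *
        ∏ a : Fin (k p.castSucc), ∏ b : Fin (k p.castSucc),
          if a < b then (z.1 p.castSucc a - z.1 p.castSucc b + z.2.1)⁻¹ else 1) *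
      ((∏ a : Fin (k p.castSucc), ∏ b : Fin (k p.succ),
          if b < I.tilde p a then z.1 p.castSucc a - z.1 p.succ b - z.2.1 / 2 else 1) *
        ∏ a : Fin (k p.castSucc), ∏ b : Fin (k p.succ),
          if I.tilde p a < b then -z.1 p.castSucc a + z.1 p.succ b - z.2.1 / 2 else 1)) := by
  rw [partitionFn, defectChar, sub_eq_add_neg, Finsupp.prod_add_index_of_disjoint I.disjoint_support,
    Finsupp.prod_neg_index (by simp)]
  have hden : (natToExpSum k I.denForms).prod (fun w n => w z ^ (-n)) =
      I.denForms.prod fun w n => (w z)⁻¹ ^ n := by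
    refine (Finsupp.prod_mapRange_index (hf := map_zero (Nat.castAddMonoidHom ℤ)) (by simp)).trans ?_
    simp
  have hnum : (natToExpSum k I.numForms).prod (fun w n => w z ^ (-(-n))) =
      I.numForms.prod fun w n => (w z) ^ n := by
    refine (Finsupp.prod_mapRange_index (hf := map_zero (Nat.castAddMonoidHom ℤ)) (by simp)).trans ?_
    simp
  have hden' := prod_pow_sum_ite (ι := Fin M) (α := fun p => Fin (k p.castSucc))
    (β := fun p => Fin (k p.castSucc)) (fun p a b => b < a) (fun p a b => a < b)
    (fun p a b => coordForm (k := k) p.castSucc a - coordForm p.castSucc b)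
    (fun p a b => coordForm p.castSucc a - coordForm p.castSucc b + gammaForm k)
    (fun w => (w z)⁻¹)
  have hnum' := prod_pow_sum_ite (ι := Fin M) (α := fun p => Fin (k p.castSucc))
    (β := fun p => Fin (k p.succ)) (fun p a b => b < I.tilde p a) (fun p a b => I.tilde p a < b)
    (fun p a b => coordForm (k := k) p.castSucc a - coordForm p.succ b - (1 / 2 : ℂ) • gammaForm k)
    (fun p a b => -coordForm p.castSucc a + coordForm p.succ b - (1 / 2 : ℂ) • gammaForm k)
    (fun w => w z)
  rw [hden, hnum, denForms, numForms, hden', hnum', ← Finset.prod_mul_distrib]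
  have hhalf : (1 / 2 : ℂ) * z.2.1 = z.2.1 / 2 := by ring
  simp only [LinearMap.sub_apply, LinearMap.add_apply, LinearMap.neg_apply, LinearMap.smul_apply,
    coordForm_apply, gammaForm_apply, smul_eq_mul, hhalf]

lemma prod_Ioi_comp_perm {n : ℕ} (σ : Equiv.Perm (Fin n)) {g : Fin n → Fin n → ℂ}
    (hg : ∀ a b, g a b = g b a) :
    ∏ a, ∏ b ∈ Finset.Ioi a, g (σ a) (σ b) = ∏ a, ∏ b ∈ Finset.Ioi a, g a b := by
  -- The sign rule for antisymmetric functions is applied to `s` and to `g * s`, and the sign of `σ`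
  -- cancels.
  let s : Fin n → Fin n → ℂ := fun a b => if a < b then 1 else if b < a then -1 else 0
  have hs : ∀ a b, s a b = -s b a := by
    intro a b
    rcases lt_trichotomy a b with h | h | h
    · simp [s, h, h.not_gt]
    · simp [s, h]
    · simp [s, h, h.not_gt]
  have hs1 : ∏ a, ∏ b ∈ Finset.Ioi a, s a b = 1 :=
    Finset.prod_eq_one fun a _ => Finset.prod_eq_one fun b hb => if_pos (Finset.mem_Ioi.1 hb)
  have h1 := σ.prod_Ioi_comp_eq_sign_mul_prod hs
  have h2 := σ.prod_Ioi_comp_eq_sign_mul_prod (f := fun a b => g a b * s a b)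
    (fun a b => by rw [hs, hg]; ring)
  simp only [Finset.prod_mul_distrib] at h2
  rw [h1, hs1, mul_one, mul_one, mul_comm] at h2
  exact mul_left_cancel₀ (by
    rcases Int.units_eq_one_or (Equiv.Perm.sign σ) with h | h <;> simp [h]) h2

lemma prod_ite_lt {n : ℕ} (t : Fin n) (g : Fin n → ℂ) :
    ∏ b, (if b < t then g b else 1) = ∏ b ∈ Finset.Iio t, g b := by
  rw [← Finset.prod_filter]
  congr 1
  ext
  simp

lemma prod_ite_gt {n : ℕ} (t : Fin n) (g : Fin n → ℂ) :
    ∏ b, (if t < b then g b else 1) = ∏ b ∈ Finset.Ioi t, g b := by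
  rw [← Finset.prod_filter]
  congr 1
  ext
  simp

lemma normalized_block_eq_omega {n L : ℕ} (γ : ℂ) (t : Fin n → Fin L) (u : Fin n → ℂ)
    (v : Fin L → ℂ) (hγ : ∀ a b, a ≠ b → u a - u b + γ ≠ 0) :
    ((-1 : ℂ) ^ (n * L + ∑ a, ((t a : ℕ) + 1)) *
      ∏ a, ∏ b ∈ Finset.Ioi a, (γ ^ 2 - (u a - u b) ^ 2)) *
      (((∏ a, ∏ b, if b < a then (u a - u b)⁻¹ else 1) *
        ∏ a, ∏ b, if a < b then (u a - u b + γ)⁻¹ else 1) *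
      ((∏ a, ∏ b, if b < t a then u a - v b - γ / 2 else 1) *
        ∏ a, ∏ b, if t a < b then -u a + v b - γ / 2 else 1)) = omega γ t u v := by
  have h1 : ∏ a, ∏ b, (if b < a then (u a - u b)⁻¹ else 1) =
      ∏ a, ∏ b ∈ Finset.Ioi a, (u b - u a)⁻¹ := by
    rw [Finset.prod_comm]
    simp only [prod_ite_gt]
  have h2 : ∏ a, ∏ b, (if t a < b then -u a + v b - γ / 2 else 1) =
      (∏ a, (-1 : ℂ) ^ (L - 1 - (t a : ℕ))) *
        ∏ a, ∏ b ∈ Finset.Ioi (t a), (u a - v b + γ / 2) := by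
    rw [← Finset.prod_mul_distrib]
    refine Finset.prod_congr rfl fun a _ => ?_
    rw [prod_ite_gt, ← Fin.card_Ioi, ← Finset.prod_const, ← Finset.prod_mul_distrib]
    exact Finset.prod_congr rfl fun b _ => by ring
  -- The factors to the right of position $t_a$ contribute $L-1-t_a$ signs; with $t_a+1$ from the
  -- normalization they sum to $nL$, so the total exponent is $2nL$.
  have h3 : (-1 : ℂ) ^ (n * L + ∑ a, ((t a : ℕ) + 1)) * ∏ a, (-1 : ℂ) ^ (L - 1 - (t a : ℕ)) = 1 := by
    rw [Finset.prod_pow_eq_pow_sum, ← pow_add, add_assoc, ← Finset.sum_add_distrib]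
    have : ∀ a, (t a : ℕ) + 1 + (L - 1 - (t a : ℕ)) = L := fun a => by omega
    simp only [this, Finset.sum_const, Finset.card_univ, Fintype.card_fin, smul_eq_mul]
    exact Even.neg_one_pow (by rw [← two_mul]; exact even_two_mul _)
  have h4 : (∏ a, ∏ b ∈ Finset.Ioi a, (γ ^ 2 - (u a - u b) ^ 2)) *
      ((∏ a, ∏ b ∈ Finset.Ioi a, (u b - u a)⁻¹) *
        ∏ a, ∏ b ∈ Finset.Ioi a, (u a - u b + γ)⁻¹) =
      ∏ a, ∏ b ∈ Finset.Ioi a, (u a - u b - γ) / (u a - u b) := by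
    simp only [← Finset.prod_mul_distrib]
    refine Finset.prod_congr rfl fun a _ => Finset.prod_congr rfl fun b hb => ?_
    have h := hγ a b (Finset.mem_Ioi.1 hb).ne
    have h' : u b - u a = -(u a - u b) := by ring
    have h'' : γ ^ 2 - (u a - u b) ^ 2 = -((u a - u b - γ) * (u a - u b + γ)) := by ring
    calc _ = (u a - u b - γ) * (u a - u b)⁻¹ * ((u a - u b + γ) * (u a - u b + γ)⁻¹) := by
          rw [h', h'', inv_neg]
          ring
      _ = _ := by rw [mul_inv_cancel₀ h, mul_one, div_eq_mul_inv]
  rw [h1, h2, omega, ← h4, Finset.prod_mul_distrib]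
  simp only [prod_ite_lt, prod_ite_gt]
  linear_combination ((∏ a, ∏ b ∈ Finset.Ioi a, (γ ^ 2 - (u a - u b) ^ 2)) *
      ((∏ a, ∏ b ∈ Finset.Ioi a, (u b - u a)⁻¹) *
        ∏ a, ∏ b ∈ Finset.Ioi a, (u a - u b + γ)⁻¹) *
      ((∏ a, ∏ b ∈ Finset.Iio (t a), (u a - v b - γ / 2)) *
        ∏ a, ∏ b ∈ Finset.Ioi (t a), (u a - v b + γ / 2))) * h3

theorem NestedSets.normalizedDefect_eq_symOmega (γ ħ : ℂ)
    (u : ∀ p : Fin M, Fin (k p.castSucc) → ℂ) (m : Fin (k (Fin.last M)) → ℂ)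
    (hγ : ∀ p a b, a ≠ b → u p a - u p b + γ ≠ 0) :
    I.normalizedDefect I.defectChar γ ħ u m = I.symOmega γ u m := by
  rw [normalizedDefect, defect, sym, symOmega, sym, Finset.mul_sum]
  refine Finset.sum_congr rfl fun σ _ => ?_
  rw [I.partitionFn_defectChar, ← Finset.prod_mul_distrib]
  refine Finset.prod_congr rfl fun p _ => ?_
  have h := normalized_block_eq_omega γ (I.tilde p) (fun a => u p (σ p a))
    (levels (fun p a => u p (σ p a)) m p.succ)
    fun a b hab => hγ p _ _ ((σ p).injective.ne hab)
  -- The normalizing product is symmetric, so it may be moved under the symmetrization.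
  rw [prod_Ioi_comp_perm (σ p) (g := fun a b => γ ^ 2 - (u p a - u p b) ^ 2)
    (fun a b => by ring)] at h
  dsimp only
  rw [levels_castSucc]
  exact h

end Defect

end AMQuiver

end

theorem mainTheorem1 {M : ℕ} {k : Fin (M + 1) → ℕ} (I : AMQuiver.NestedSets k) :
    -- the character of the orbifold defect exists and is unique
    (∃! c : AMQuiver.ExpSum k, I.IsDefectChar c) ∧
    -- the normalized orbifold defect is the symmetrized product of blocks
    (∀ c : AMQuiver.ExpSum k, I.IsDefectChar c →
      ∀ (γ ħ : ℂ) (u : ∀ p : Fin M, Fin (k p.castSucc) → ℂ) (m : Fin (k (Fin.last M)) → ℂ),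
        (∀ p, Function.Injective (u p)) →
        (∀ p a b, a ≠ b → u p a - u p b + γ ≠ 0) →
          I.normalizedDefect c γ ħ u m = I.symOmega γ u m) ∧
    -- up to a factor that does not depend on the index sets,
    -- it is the nested coordinate Bethe wavefunction
    (∀ (γ : ℂ) (u : ∀ p : Fin M, Fin (k p.castSucc) → ℂ) (m : Fin (k (Fin.last M)) → ℂ),
        (∀ p, Function.Injective (u p)) →
        (∀ p a b, u p a - AMQuiver.levels u m p.succ b + γ / 2 ≠ 0) →
          I.symOmega γ u m =
            (∏ p, ∏ a, ∏ b, (u p a - AMQuiver.levels u m p.succ b + γ / 2)) *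
              AMQuiver.nestedBethe γ k I.tilde u m) ∧
    -- for `γ = 1`, it is the partition function of the vertex model
    (∀ (u : ∀ p : Fin M, Fin (k p.castSucc) → ℂ) (m : Fin (k (Fin.last M)) → ℂ),
        (∀ p, Function.Injective (u p)) →
          I.symOmega 1 u m =
            AMQuiver.latticePartitionFn I.colour
              (fun p a => u p a - ((M : ℂ) - ((p : ℕ) : ℂ)) / 2) m) := by
  refine ⟨⟨I.defectChar, I.isDefectChar_defectChar, fun c hc =>
      hc.unique I.isDefectChar_defectChar⟩, fun c hc γ ħ u m _ hγ => ?_,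
    fun γ u m _ h => I.symOmega_eq_nestedBethe γ u m h, I.symOmega_one_eq⟩
  rw [hc.unique I.isDefectChar_defectChar]
  exact I.normalizedDefect_eq_symOmega γ ħ u m hγ
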